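/- **Setting.** A tree means a finite rooted planar binary tree (every node has zero or two children); its leaves are numbered $0,\dots,n-1$ from left to right and correspond to the standard dyadic intervals obtained by repeated halving of $[0,1]$. For trees $T_+,T_-$ with the same number $n$ of leaves, let $g(T_+,T_-)$ be the homeomorphism of $[0,1]$ that maps the $i$-th leaf interval of $T_+$ affinely and increasingly onto the $i$-th leaf interval of $T_-$, for all $i$. Thompson's group $F$ is the group of all these homeomorphisms. The signed plane graph $\Gamma(T_+,T_-)$ is defined as follows. Draw $T_+$ in the upper half-plane and the reflection of $T_-$ in the lower half-plane, with common leaves on the horizontal axis. For each $i$ there is a vertex $v_i$ on the axis just to the left of leaf $i$, $0\le i<n$. For each interior node of $T_+$ there is a positive edge in the upper half-plane that crosses, among the edges of $T_+$, exactly the one from the node to its left child; thus, if the first leaf below the left child is $a$ and the first leaf below the right child is $b$, this edge joins $v_a$ to $v_b$. In the same way each interior node of $T_-$ gives a negative edge in the lower half-plane. The link diagram $L(T_+,T_-)$ is the medial graph of $\Gamma(T_+,T_-)$, with one crossing on each edge: when the edge is drawn horizontally, with its left endpoint on the left, the strand from bottom left to top right is the upper one if the edge is positive, and the strand from top left to bottom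 right is the upper one if the edge is negative. If $n=1$, then $L(T_+,T_-)$ is a circle without crossings. For $A\in\mathbb C\setminus\{0\}$, the Kauffman bracket $\langle D\rangle(A)$ of an unoriented link diagram $D$ is given by $\langle O\rangle=1$ for a circle $O$ without crossings, $\langle D\sqcup O\rangle=(-A^2-A^{-2})\langle D\rangle$, and the skein relation $\langle D\rangle=A\langle D'\rangle+A^{-1}\langle D''\rangle$, where a crossing of $D$, drawn with the strand from bottom left to top right as the upper one, is replaced in $D'$ by $)\,($ and in $D''$ by $\asymp$. A function $\phi:G\to\mathbb C$ on a group $G$ is of positive type if $\sum_{i,j=1}^r a_i\overline{a_j}\,\phi(g_ig_j^{-1})\ge 0$ for all $r$, all $g_1,\dots,g_r\in G$ and all $a_1,\dots,a_r\in\mathbb C$. **Theorem.** Let $Q\in\{2,3,4\}$ and let $A\in\mathbb C$ be any solution of $A^2+A^{-2}+\sqrt Q=0$. Then $A$ is a root of unity; the function $$\langle g\rangle(A)=(-A^2-A^{-2})^{-n}\,\langle L(T_+,T_-)\rangle(A),\qquad g=g(T_+,T_-)\in F,\quad n=\text{number of leaves of }T_+ \text{ (and of } T_-),$$ is well defined on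 $F$, i.e. its value does not depend on the pair $(T_+,T_-)$ that represents $g$; and $g\mapsto\langle g\rangle(A)$ is of positive type on $F$. -/

import Mathlib

namespace ThompsonLink

/-! ## Trees, dyadic subdivisions and Thompson's group

Rooted planar binary trees are `BinaryTree Unit`; `nil` is the one-leaf tree. -/

/-- The piecewise linear map which carries the `i`-th leaf interval of the tree `T` (a standard
dyadic subinterval of `[0, 1]`, leaves being numbered from the left starting with `0`) affinely
onto `[i, i + 1]`. It maps `[0, 1]` onto `[0, n]`, where `n` is the number of leaves. -/
noncomputable def unfold : BinaryTree Unit → ℝ → ℝ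
  | .nil, x => x
  | .node _ l r, x =>
      if x ≤ 1 / 2 then unfold l (2 * x) else (l.numLeaves : ℝ) + unfold r (2 * x - 1)

theorem unfold_zero : ∀ T : BinaryTree Unit, unfold T 0 = 0
  | .nil => rfl
  | .node _ l r => by simp [unfold, unfold_zero l]

theorem unfold_one : ∀ T : BinaryTree Unit, unfold T 1 = T.numLeaves
  | .nil => by simp [unfold]
  | .node _ l r => by
      have h : ¬ ((1 : ℝ) ≤ 1 / 2) := by norm_num
      have h' : (2 * 1 - 1 : ℝ) = 1 := by norm_num
      simp only [unfold, if_neg h, h', unfold_one r, BinaryTree.numLeaves]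
      push_cast
      ring

theorem unfold_strictMono : ∀ T : BinaryTree Unit, StrictMono (unfold T)
  | .nil => fun _ _ h => h
  | .node _ l r => by
      intro x y hxy
      simp only [unfold]
      split_ifs with hx hy hy
      · exact unfold_strictMono l (by linarith)
      · have h1 : unfold l (2 * x) ≤ l.numLeaves := by
          rw [← unfold_one l]
          exact (unfold_strictMono l).monotone (by linarith)
        have h2 : 0 < unfold r (2 * y - 1) := by
          rw [← unfold_zero r]
          exact unfold_strictMono r (by linarith)
        linarith
      · linarith
      · have := unfold_strictMono r (show 2 * x - 1 < 2 * y - 1 by linarith)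
        linarith

theorem unfold_continuous : ∀ T : BinaryTree Unit, Continuous (unfold T)
  | .nil => continuous_id
  | .node _ l r => by
      have hl := unfold_continuous l
      have hr := unfold_continuous r
      simp only [unfold]
      refine Continuous.if_le (by fun_prop) (by fun_prop) (by fun_prop) (by fun_prop) ?_
      rintro x rfl
      norm_num [unfold_one, unfold_zero]

/-- `unfold T` as an increasing bijection of `[0, 1]` onto `[0, n]`. -/
noncomputable def unfoldIso (T : BinaryTree Unit) :
    Set.Icc (0 : ℝ) 1 ≃o Set.Icc (0 : ℝ) (T.numLeaves : ℝ) :=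
  StrictMono.orderIsoOfSurjective
    (fun x => ⟨unfold T x,
      (unfold_zero T).symm.le.trans ((unfold_strictMono T).monotone x.2.1),
      ((unfold_strictMono T).monotone x.2.2).trans (unfold_one T).le⟩)
    (fun x y h => unfold_strictMono T h)
    (by
      rintro ⟨y, hy⟩
      rw [← unfold_zero T, ← unfold_one T] at hy
      obtain ⟨x, hx, rfl⟩ :=
        intermediate_value_Icc (zero_le_one' ℝ) (unfold_continuous T).continuousOn hy
      exact ⟨⟨x, hx⟩, rfl⟩)

/-- The homeomorphism `g(T₊, T₋)` of `[0, 1]` determined by two trees with the same number of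
leaves: it maps the `i`-th leaf interval of `T₊` affinely onto the `i`-th leaf interval of
`T₋`. -/
noncomputable def treePairMap (Tp Tm : BinaryTree Unit) (h : Tp.numLeaves = Tm.numLeaves) :
    unitInterval ≃ₜ unitInterval :=
  ((unfoldIso Tp).trans
    ((OrderIso.setCongr _ _ (by rw [h])).trans (unfoldIso Tm).symm)).toHomeomorph

theorem unfold_treePairMap (Tp Tm : BinaryTree Unit) (h : Tp.numLeaves = Tm.numLeaves)
    (x : unitInterval) : unfold Tm (treePairMap Tp Tm h x) = unfold Tp x := by
  have : unfoldIso Tm (treePairMap Tp Tm h x)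
      = OrderIso.setCongr _ _ (by rw [h]) (unfoldIso Tp x) :=
    (unfoldIso Tm).apply_symm_apply _
  exact congrArg Subtype.val this

theorem eq_treePairMap {Tp Tm : BinaryTree Unit} (h : Tp.numLeaves = Tm.numLeaves)
    {f : unitInterval ≃ₜ unitInterval} (hf : ∀ x, unfold Tm (f x) = unfold Tp x) :
    f = treePairMap Tp Tm h := by
  ext x
  exact (unfold_strictMono Tm).injective ((hf x).trans (unfold_treePairMap Tp Tm h x).symm)

/-- Attach the tree `φ i` at the `i`-th leaf of a tree, for every `i`. -/
def attach : BinaryTree Unit → (ℕ → BinaryTree Unit) → BinaryTree Unit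
  | .nil, φ => φ 0
  | .node _ l r, φ => .node () (attach l φ) (attach r fun i => φ (l.numLeaves + i))

theorem numLeaves_attach : ∀ (T : BinaryTree Unit) (φ : ℕ → BinaryTree Unit),
    (attach T φ).numLeaves = ∑ i ∈ Finset.range T.numLeaves, (φ i).numLeaves
  | .nil, φ => by simp [attach]
  | .node _ l r, φ => by
      simp [attach, numLeaves_attach l, numLeaves_attach r, Finset.sum_range_add]

/-- The concatenation of the maps `unfold (φ i)`. -/
noncomputable def unfoldForest (φ : ℕ → BinaryTree Unit) (y : ℝ) : ℝ :=
  ((∑ i ∈ Finset.range ⌊y⌋₊, (φ i).numLeaves : ℕ) : ℝ) + unfold (φ ⌊y⌋₊) (y - ⌊y⌋₊)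

theorem unfoldForest_natCast_add (φ : ℕ → BinaryTree Unit) (n : ℕ) {y : ℝ} (hy : 0 ≤ y) :
    unfoldForest φ (n + y) = ((∑ i ∈ Finset.range n, (φ i).numLeaves : ℕ) : ℝ)
      + unfoldForest (fun i => φ (n + i)) y := by
  have h : ⌊(n : ℝ) + y⌋₊ = n + ⌊y⌋₊ := by
    rw [add_comm, Nat.floor_add_natCast hy, add_comm]
  simp only [unfoldForest, h, Finset.sum_range_add]
  push_cast
  rw [add_sub_add_left_eq_sub, add_assoc]

theorem unfold_attach : ∀ (T : BinaryTree Unit) (φ : ℕ → BinaryTree Unit) {x : ℝ},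
    0 ≤ x → x ≤ 1 → unfold (attach T φ) x = unfoldForest φ (unfold T x)
  | .nil, φ, x, h0, h1 => by
      rcases h1.lt_or_eq with h | rfl
      · have : ⌊x⌋₊ = 0 := Nat.floor_eq_zero.2 h
        simp [attach, unfold, unfoldForest, this]
      · simp [attach, unfold, unfoldForest, unfold_zero, unfold_one]
  | .node _ l r, φ, x, h0, h1 => by
      simp only [attach, unfold]
      split_ifs with hx
      · exact unfold_attach l φ (by linarith) (by linarith)
      · have hr : 0 ≤ unfold r (2 * x - 1) := by
          rw [← unfold_zero r]
          exact (unfold_strictMono r).monotone (by linarith)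
        rw [unfold_attach r _ (by linarith) (by linarith), unfoldForest_natCast_add φ _ hr,
          numLeaves_attach]

theorem treePairMap_attach (Tp Tm : BinaryTree Unit) (h : Tp.numLeaves = Tm.numLeaves)
    (φ : ℕ → BinaryTree Unit) :
    treePairMap Tp Tm h = treePairMap (attach Tp φ) (attach Tm φ)
      (by rw [numLeaves_attach, numLeaves_attach, h]) := by
  apply eq_treePairMap
  intro x
  rw [unfold_attach _ _ (treePairMap Tp Tm h x).2.1 (treePairMap Tp Tm h x).2.2,
    unfold_attach _ _ x.2.1 x.2.2, unfold_treePairMap]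

theorem exists_common_attach : ∀ S T : BinaryTree Unit,
    ∃ φ ψ : ℕ → BinaryTree Unit, attach S φ = attach T ψ
  | .nil, T => by
      refine ⟨fun _ => T, fun _ => .nil, ?_⟩
      have : ∀ T : BinaryTree Unit, attach T (fun _ => .nil) = T := by
        intro T
        induction T with
        | nil => rfl
        | node a l r hl hr => simp [attach, hl, hr]
      rw [this]
      rfl
  | .node a l r, .nil => by
      refine ⟨fun _ => .nil, fun _ => .node a l r, ?_⟩
      have : ∀ T : BinaryTree Unit, attach T (fun _ => .nil) = T := by
        intro T
        induction T with
        | nil => rfl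
        | node a l r hl hr => simp [attach, hl, hr]
      rw [this]
      rfl
  | .node _ l r, .node _ l' r' => by
      obtain ⟨φ₁, ψ₁, h₁⟩ := exists_common_attach l l'
      obtain ⟨φ₂, ψ₂, h₂⟩ := exists_common_attach r r'
      have key : ∀ (T : BinaryTree Unit) (φ φ' : ℕ → BinaryTree Unit),
          (∀ i < T.numLeaves, φ i = φ' i) → attach T φ = attach T φ' := by
        intro T
        induction T with
        | nil => intro φ φ' h; exact h 0 (by simp)
        | node a l r hl hr =>
          intro φ φ' h
          simp only [BinaryTree.numLeaves] at h
          simp only [attach]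
          rw [hl φ φ' fun i hi => h i (by omega), hr _ _ fun i hi => h _ (by omega)]
      refine ⟨fun i => if i < l.numLeaves then φ₁ i else φ₂ (i - l.numLeaves),
        fun i => if i < l'.numLeaves then ψ₁ i else ψ₂ (i - l'.numLeaves), ?_⟩
      simp only [attach]
      rw [key l _ φ₁ fun i hi => if_pos hi, key l' _ ψ₁ fun i hi => if_pos hi, h₁]
      simp [h₂]

/-- Thompson's group `F`: the group of all homeomorphisms `g(T₊, T₋)` of `[0, 1]`, under
composition. -/
def thompsonF : Subgroup (unitInterval ≃ₜ unitInterval) where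
  carrier := {f | ∃ (Tp Tm : BinaryTree Unit) (h : Tp.numLeaves = Tm.numLeaves),
    f = treePairMap Tp Tm h}
  one_mem' := ⟨.nil, .nil, rfl, eq_treePairMap rfl fun _ => rfl⟩
  inv_mem' := by
    rintro _ ⟨Tp, Tm, h, rfl⟩
    refine ⟨Tm, Tp, h.symm, eq_treePairMap h.symm fun x => ?_⟩
    rw [← unfold_treePairMap Tp Tm h]
    exact congrArg (fun y : unitInterval => unfold Tm y)
      ((treePairMap Tp Tm h).apply_symm_apply x)
  mul_mem' := by
    rintro _ _ ⟨S, S', hS, rfl⟩ ⟨T, T', hT, rfl⟩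
    obtain ⟨φ, ψ, h⟩ := exists_common_attach S T'
    refine ⟨attach T ψ, attach S' φ, ?_, ?_⟩
    · rw [numLeaves_attach T, hT, ← numLeaves_attach T', ← h, numLeaves_attach S, hS,
        ← numLeaves_attach S']
    · rw [treePairMap_attach S S' hS φ, treePairMap_attach T T' hT ψ]
      apply eq_treePairMap
      intro x
      rw [Homeomorph.mul_apply, unfold_treePairMap, h, unfold_treePairMap]

/-- `g(T₊, T₋)` as an element of `F`. -/
noncomputable def toF (Tp Tm : BinaryTree Unit) (h : Tp.numLeaves = Tm.numLeaves) : thompsonF :=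
  ⟨treePairMap Tp Tm h, Tp, Tm, h, rfl⟩

/-! ## Link diagrams and the Kauffman bracket -/

/-- An unoriented link diagram with crossing set `C`, up to isotopy. Around each crossing `c` the
four strand ends are placed at the corners of a square: `(c, east, north)` is the end at the
corner given by the two Booleans (so that `(c, false, true)` is the north-west end). The two
strands are the diagonals of the square; `slash c` says that the strand from south-west to
north-east is the upper one, otherwise it is the strand from north-west to south-east. Outside the
crossings, the arcs of the diagram connect the ends in pairs (`glue`), and there are `circles`
further closed components without crossings. -/
structure LinkDiagram (C : Type) where
  slash : C → Bool
  glue : C × Bool × Bool → C × Bool × Bool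
  glue_glue : ∀ x, glue (glue x) = x
  glue_ne : ∀ x, glue x ≠ x
  circles : ℕ

namespace LinkDiagram

variable {C : Type} (D : LinkDiagram C)

/-- The reconnection of the ends at the crossings in the state `s`; `s c = true` means that the
crossing `c` gets the smoothing which has coefficient `A` in the skein relation. That is the
smoothing `)(`, joining north-west to south-west and north-east to south-east, if the strand from
south-west to north-east is the upper one, and the other smoothing `≍` if it is the lower one. -/
def smooth (s : C → Bool) : C × Bool × Bool → C × Bool × Bool
  | (c, east, north) => if s c = D.slash c then (c, east, !north) else (c, !east, north)

/-- The number of closed curves which are left when all crossings are smoothed according to the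
state `s`. -/
noncomputable def loops (s : C → Bool) : ℕ :=
  Nat.card (Quot fun x y : C × Bool × Bool => y = D.glue x ∨ y = D.smooth s x) + D.circles

/-- The Kauffman bracket of a diagram at a nonzero complex number `A`, as the sum over all states.
It is the result of expanding every crossing by the skein relation, when `k` disjoint circles have
the value `(-A² - A⁻²) ^ (k - 1)`. -/
noncomputable def kauffmanBracket [Fintype C] [DecidableEq C] (A : ℂ) : ℂ :=
  ∑ s : C → Bool, A ^ (∑ c, if s c then (1 : ℤ) else -1) *
    (-A ^ 2 - A ^ (-2 : ℤ)) ^ ((D.loops s : ℤ) - 1)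

end LinkDiagram

/-! ## Signed plane graphs and their medial link diagrams -/

/-- A signed graph, with directed edge set `E`, drawn on an oriented surface, up to isotopy (a
combinatorial map). The dart `(e, false)` is the initial half of the edge `e`, the dart
`(e, true)` its final half. Each dart is attached to a vertex, and `next` sends a dart to the next
one in the counterclockwise order around that vertex; so the vertices are the cycles of `next`
(fixed points included), together with `isolated` further vertices without edges. -/
structure SignedMap (E : Type) where
  positive : E → Bool
  next : Equiv.Perm (E × Bool)
  isolated : ℕ

namespace SignedMap

variable {E : Type} (G : SignedMap E)

/-- The arcs of the medial graph of `G`. Its vertices are the edges of `G`. For the description of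
the four ends at an edge `e`, the edge is drawn from west to east. Looking along a dart `d` away
from its vertex, there is one end on the left of `d` and one on the right of `d`. For every corner
of `G`, given by a dart `d` and the dart `next d`, an arc of the medial graph connects the end on
the left of `d` to the end on the right of `next d`. -/
def medialGlue : E × Bool × Bool → E × Bool × Bool
  | (e, b, north) =>
      if north = !b then
        ((G.next (e, b)).1, (G.next (e, b)).2, (G.next (e, b)).2)
      else
        ((G.next.symm (e, b)).1, (G.next.symm (e, b)).2, !(G.next.symm (e, b)).2)

/-- The link diagram of a signed plane graph: the medial graph, with the crossing of south-west to
north-east over north-west to south-east at each positive edge, and the opposite one at each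
negative edge, where the edge is drawn from west to east. The medial curve of an isolated vertex
is a circle. -/
def medialDiagram : LinkDiagram E where
  slash := G.positive
  glue := G.medialGlue
  glue_glue := by
    rintro ⟨e, b, n⟩
    by_cases h : n = !b
    · subst h
      simp [medialGlue]
    · obtain rfl : n = b := by revert h; cases n <;> cases b <;> simp
      simp [medialGlue]
  glue_ne := by
    rintro ⟨e, b, n⟩ h
    by_cases hn : n = !b
    · subst hn
      simp only [medialGlue, if_true, Prod.mk.injEq] at h
      have := h.2.1.symm.trans h.2.2
      cases b <;> exact absurd this (by decide)
    · obtain rfl : n = b := by revert hn; cases n <;> cases b <;> simp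
      simp only [medialGlue] at h
      rw [if_neg (by cases n <;> simp)] at h
      simp only [Prod.mk.injEq] at h
      have := (congrArg not h.2.1).symm.trans h.2.2
      cases n <;> exact absurd this (by decide)
  circles := G.isolated

end SignedMap

/-! ## The graph and the link of a pair of trees -/

/-- The carets (internal nodes) of a tree. -/
def Caret : BinaryTree Unit → Type
  | .nil => Empty
  | .node _ l r => Option (Caret l ⊕ Caret r)

instance instDecidableEqCaret : ∀ T : BinaryTree Unit, DecidableEq (Caret T)
  | .nil => inferInstanceAs (DecidableEq Empty)
  | .node _ l r =>
      haveI := instDecidableEqCaret l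
      haveI := instDecidableEqCaret r
      inferInstanceAs (DecidableEq (Option (Caret l ⊕ Caret r)))

instance instFintypeCaret : ∀ T : BinaryTree Unit, Fintype (Caret T)
  | .nil => inferInstanceAs (Fintype Empty)
  | .node _ l r =>
      haveI := instFintypeCaret l
      haveI := instFintypeCaret r
      inferInstanceAs (Fintype (Option (Caret l ⊕ Caret r)))

/-- The half-graph of `T`, drawn in the upper half-plane. Draw `T` in the upper half-plane with
its leaves on the horizontal axis. The vertex `v` of the graph lies on the axis just to the left
of the leaf number `v`, for `0 ≤ v < n`. For each caret there is one edge, which crosses the left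
branch of the caret (and no other edge of `T`): if the caret has the subtrees `l` and `r`, then it
goes from the vertex to the left of the first leaf of `l` to the vertex to the left of the first
leaf of `r`. Thus the edge of the root caret is outside all others.
`fan T v` lists the darts at the vertex `v` in counterclockwise order, from east to west. -/
def fan : (T : BinaryTree Unit) → ℕ → List (Caret T × Bool)
  | .nil, _ => []
  | .node _ l r, v =>
      if v < l.numLeaves then
        (fan l v).map (fun d => (some (Sum.inl d.1), d.2)) ++
          if v = 0 then [(none, false)] else []
      else
        (fan r (v - l.numLeaves)).map (fun d => (some (Sum.inr d.1), d.2)) ++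
          if v = l.numLeaves then [(none, true)] else []

/-- The darts of the graph `Γ(T₊, T₋)` at the vertex `v`, in counterclockwise order: first those of
the half-graph of `T₊` in the upper half-plane, then those of the half-graph of `T₋`, reflected
into the lower half-plane. -/
def star (Tp Tm : BinaryTree Unit) (v : ℕ) : List ((Caret Tp ⊕ Caret Tm) × Bool) :=
  (fan Tp v).map (fun d => (Sum.inl d.1, d.2)) ++
    ((fan Tm v).map fun d => (Sum.inr d.1, d.2)).reverse

/-- The signed plane graph `Γ(T₊, T₋)` of two trees with the same number of leaves; the edges in
the upper half-plane are positive, those in the lower half-plane are negative, and all are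
directed from left to right. -/
def gammaGraph (Tp Tm : BinaryTree Unit) : SignedMap (Caret Tp ⊕ Caret Tm) where
  positive := Sum.isLeft
  next := ((List.range Tp.numLeaves).map fun v => (star Tp Tm v).formPerm).prod
  isolated := ((List.range Tp.numLeaves).filter fun v => (star Tp Tm v).isEmpty).length

/-- The link diagram `L(T₊, T₋)`. -/
def linkOfTrees (Tp Tm : BinaryTree Unit) : LinkDiagram (Caret Tp ⊕ Caret Tm) :=
  (gammaGraph Tp Tm).medialDiagram

/-- The Kauffman bracket of `L(T₊, T₋)`, normalized by the factor `(-A² - A⁻²) ^ (-n)`, where `n`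
is the number of leaves of each of the two trees. -/
noncomputable def normalizedBracket (A : ℂ) (Tp Tm : BinaryTree Unit) : ℂ :=
  (-A ^ 2 - A ^ (-2 : ℤ)) ^ (-(Tp.numLeaves : ℤ)) * (linkOfTrees Tp Tm).kauffmanBracket A

/-- The function `g ↦ ⟨g⟩(A)` on `F`: the normalized bracket of any pair of trees which represents
`g`. -/
noncomputable def kauffmanFunction (A : ℂ) (g : thompsonF) : ℂ :=
  normalizedBracket A g.2.choose g.2.choose_spec.choose

open scoped ComplexOrder in
/-- Functions of positive type on a group; `0 ≤ z` means that `z` is real and nonnegative.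
(Replacing all `g i` by their inverses shows that the opposite product leads to the same
functions of positive type.) -/
def IsPositiveType {G : Type*} [Group G] (φ : G → ℂ) : Prop :=
  ∀ (r : ℕ) (g : Fin r → G) (a : Fin r → ℂ),
    0 ≤ ∑ i, ∑ j, a i * starRingEnd ℂ (a j) * φ (g i * (g j)⁻¹)

end ThompsonLink

/-! The bracket of a medial diagram is the partition function of a Potts model. A state deletes some
edges of the plane graph and keeps a set `S` of the others, and its loops are the faces of the
spanning subgraph `S`. With `d = -A² - A⁻² = √Q`, Euler's formula turns `d` to the number of loops
into `Q` to the number of components times `d ^ |S|`, up to a constant. As `Q` is a positive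
integer, this power of `Q` counts the colourings of the vertices by `Q` spins which are constant on
components. The state sum thus becomes a sum over spin configurations of a product of edge weights
(`kauffmanBracket_medialDiagram`).

For `Γ(T₊, T₋)` the product splits into an upper and a lower half, so the normalized bracket is
`d⁻¹` times the average of a weight of `T₊` times a weight of `T₋` (`normalizedBracket_eq_sum`).
Attaching the same trees to both sides adds factors which average to 1, because `A² + A⁻² = -d`
(`spinMean_forest`). Two pairs representing one element become equal after such attachments, hence
the function is well defined.

For positivity, `A` is a root of unity, so `|A| = 1` and the weights in the lower half are the
complex conjugates of those in the upper half. Finitely many elements can be written as `g(S, Tᵢ)`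
with a common `S` (`exists_common_source`). Then `gᵢ gⱼ⁻¹ = g(Tⱼ, Tᵢ)`, and the values form a Gram
matrix.

Planarity enters only through counting. The genus cannot drop when an edge is added, so Euler's
formula for every spanning subgraph follows from bounds for the empty and the full edge set
(`card_faces_add`). The bound for the full set needs `n` faces, which are found by labelling the
sides of the darts with residues modulo `n` (`numLeaves_le_card_faces`). -/

namespace ThompsonLink

/-! ## Counting classes of finite relations -/

/-- Identifying two distinct points of a finite type lowers its cardinality by one. -/
theorem card_quot_pair {Y : Type*} [Finite Y] {u v : Y} (huv : u ≠ v) :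
    Nat.card (Quot fun x y : Y => x = u ∧ y = v) + 1 = Nat.card Y := by
  classical
  have e : (Quot fun x y : Y => x = u ∧ y = v) ≃ {y : Y // y ≠ u} :=
    { toFun := Quot.lift (fun y => if h : y = u then ⟨v, huv.symm⟩ else ⟨y, h⟩) (by
        rintro x y ⟨rfl, rfl⟩
        simp [huv.symm])
      invFun := fun y => Quot.mk _ y.1
      left_inv := by
        rintro ⟨y⟩
        by_cases h : y = u
        · subst h
          simpa using (Quot.sound (r := fun x z : Y => x = y ∧ z = v) ⟨rfl, rfl⟩).symm
        · simp [h]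
      right_inv := by
        rintro ⟨y, hy⟩
        simp [hy] }
  have := Fintype.ofFinite Y
  rw [Nat.card_congr e, Nat.card_eq_fintype_card, Nat.card_eq_fintype_card,
    Fintype.card_subtype_compl, Fintype.card_subtype_eq]
  have : 0 < Fintype.card Y := Fintype.card_pos_iff.2 ⟨u⟩
  omega

/-- The quotient by a relation enlarged by one pair is an iterated quotient. -/
def quotInsertEquiv {X : Type*} (r : X → X → Prop) (a b : X) :
    (Quot fun x y => r x y ∨ (x = a ∧ y = b)) ≃
      Quot fun u v : Quot r => u = Quot.mk r a ∧ v = Quot.mk r b where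
  toFun := Quot.lift (fun x => Quot.mk _ (Quot.mk r x)) (by
    rintro x y (h | ⟨rfl, rfl⟩)
    · exact congrArg _ (Quot.sound h)
    · exact Quot.sound ⟨rfl, rfl⟩)
  invFun := Quot.lift (Quot.lift (fun x => Quot.mk _ x) fun x y h => Quot.sound (Or.inl h)) (by
    rintro u v ⟨rfl, rfl⟩
    exact Quot.sound (Or.inr ⟨rfl, rfl⟩))
  left_inv := by rintro ⟨x⟩; rfl
  right_inv := by rintro ⟨⟨x⟩⟩; rfl

theorem card_quot_insert_of_eq {X : Type*} (r : X → X → Prop) {a b : X}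
    (h : Quot.mk r a = Quot.mk r b) :
    Nat.card (Quot fun x y => r x y ∨ (x = a ∧ y = b)) = Nat.card (Quot r) := by
  refine Nat.card_congr ((quotInsertEquiv r a b).trans ?_)
  exact
    { toFun := Quot.lift id (by rintro u v ⟨rfl, rfl⟩; exact h)
      invFun := Quot.mk _
      left_inv := by rintro ⟨x⟩; rfl
      right_inv := fun x => rfl }

theorem card_quot_insert_of_ne {X : Type*} [Finite X] (r : X → X → Prop) {a b : X}
    (h : Quot.mk r a ≠ Quot.mk r b) :
    Nat.card (Quot fun x y => r x y ∨ (x = a ∧ y = b)) + 1 = Nat.card (Quot r) := by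
  rw [Nat.card_congr (quotInsertEquiv r a b), card_quot_pair h]

/-- Two relations whose quotient maps identify each other's pairs have equally many classes. -/
theorem card_quot_congr {X : Type*} {r s : X → X → Prop}
    (hrs : ∀ x y, r x y → Quot.mk s x = Quot.mk s y)
    (hsr : ∀ x y, s x y → Quot.mk r x = Quot.mk r y) :
    Nat.card (Quot r) = Nat.card (Quot s) :=
  Nat.card_congr
    { toFun := Quot.lift (Quot.mk s) hrs
      invFun := Quot.lift (Quot.mk r) hsr
      left_inv := by rintro ⟨x⟩; rfl
      right_inv := by rintro ⟨x⟩; rfl }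

/-! ## Orbits of permutations -/

/-- The orbit space of a permutation. -/
abbrev Orbits {X : Type*} (f : Equiv.Perm X) : Type _ := Quot fun x y : X => y = f x

theorem orbit_apply {X : Type*} (f : Equiv.Perm X) (x : X) :
    (Quot.mk _ (f x) : Orbits f) = Quot.mk _ x :=
  (Quot.sound (r := fun x y : X => y = f x) rfl).symm

theorem orbit_pow_apply {X : Type*} (f : Equiv.Perm X) (x : X) (k : ℕ) :
    (Quot.mk _ ((f ^ k) x) : Orbits f) = Quot.mk _ x := by
  induction k with
  | zero => rfl
  | succ k ih => rw [pow_succ', Equiv.Perm.mul_apply, orbit_apply, ih]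

section SwapMul

variable {X : Type*} [DecidableEq X]

/-- If `a` and `b` lie in different orbits of `f`, then these are merged in `swap a b * f`. -/
theorem orbit_swap_mul_eq [Finite X] (f : Equiv.Perm X) {a b : X}
    (h : (Quot.mk _ a : Orbits f) ≠ Quot.mk _ b) :
    (Quot.mk _ a : Orbits (Equiv.swap a b * f)) = Quot.mk _ b := by
  have hex : ∃ m, 0 < m ∧ (f ^ m) a = a :=
    ⟨orderOf f, orderOf_pos f, by rw [pow_orderOf_eq_one]; rfl⟩
  classical
  set m := Nat.find hex with hm
  obtain ⟨hm0, hma⟩ := Nat.find_spec hex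
  -- Before its first return to `a`, the `f`-trajectory of `a` meets neither `a` nor `b`, so the
  -- swap does nothing; at the return it sends `a` to `b`.
  have hpow : ∀ j < m, ((Equiv.swap a b * f) ^ j) a = (f ^ j) a := by
    intro j
    induction j with
    | zero => intro _; rfl
    | succ j ih =>
      intro hj
      rw [pow_succ', Equiv.Perm.mul_apply, ih (by omega), Equiv.Perm.mul_apply,
        ← Equiv.Perm.mul_apply f, ← pow_succ']
      refine Equiv.swap_apply_of_ne_of_ne (fun he => ?_) fun he => ?_
      · exact Nat.find_min hex hj ⟨by omega, he⟩
      · exact h (by rw [← orbit_pow_apply f a (j + 1), he])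
  obtain ⟨k, hk⟩ : ∃ k, m = k + 1 := ⟨m - 1, by omega⟩
  have hb : ((Equiv.swap a b * f) ^ (k + 1)) a = b := by
    rw [pow_succ', Equiv.Perm.mul_apply, hpow k (by omega), Equiv.Perm.mul_apply,
      ← Equiv.Perm.mul_apply f, ← pow_succ', ← hk, hma, Equiv.swap_apply_left]
  rw [← orbit_pow_apply (Equiv.swap a b * f) a (k + 1), hb]

/-- Once `a` and `b` are identified, the swap is invisible. The common quotient allows the orbit
counts of `f` and `swap a b * f` to be compared, since each differs from it by at most one. -/
theorem card_orbits_insert_swap_mul (f : Equiv.Perm X) (a b : X) :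
    Nat.card (Quot fun x y => y = (Equiv.swap a b * f) x ∨ (x = a ∧ y = b)) =
      Nat.card (Quot fun x y => y = f x ∨ (x = a ∧ y = b)) := by
  have key : ∀ (r : X → X → Prop) (z : X), r a b → Quot.mk r (Equiv.swap a b z) = Quot.mk r z := by
    intro r z hr
    rcases eq_or_ne z a with rfl | ha
    · rw [Equiv.swap_apply_left]; exact (Quot.sound hr).symm
    rcases eq_or_ne z b with rfl | hb
    · rw [Equiv.swap_apply_right]; exact Quot.sound hr
    · rw [Equiv.swap_apply_of_ne_of_ne ha hb]
  apply card_quot_congr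
  · rintro x y (rfl | h)
    · rw [Equiv.Perm.mul_apply, key _ _ (Or.inr ⟨rfl, rfl⟩)]
      exact Quot.sound (Or.inl rfl)
    · exact Quot.sound (Or.inr h)
  · rintro x y (rfl | h)
    · rw [← key _ (f x) (Or.inr ⟨rfl, rfl⟩)]
      exact Quot.sound (Or.inl rfl)
    · exact Quot.sound (Or.inr h)

theorem card_orbits_swap_mul_le [Finite X] (f : Equiv.Perm X) (a b : X) :
    Nat.card (Orbits (Equiv.swap a b * f)) ≤ Nat.card (Orbits f) + 1 := by
  unfold Orbits
  have h := card_orbits_insert_swap_mul f a b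
  have h1 : Nat.card (Quot fun x y => y = (Equiv.swap a b * f) x) ≤
      Nat.card (Quot fun x y => y = (Equiv.swap a b * f) x ∨ (x = a ∧ y = b)) + 1 := by
    by_cases hab : (Quot.mk _ a : Orbits (Equiv.swap a b * f)) = Quot.mk _ b
    · have := card_quot_insert_of_eq _ hab
      omega
    · have := card_quot_insert_of_ne _ hab
      omega
  have h2 : Nat.card (Quot fun x y => y = f x ∨ (x = a ∧ y = b)) ≤
      Nat.card (Quot fun x y => y = f x) := by
    by_cases hab : (Quot.mk _ a : Orbits f) = Quot.mk _ b
    · have := card_quot_insert_of_eq _ hab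
      omega
    · have := card_quot_insert_of_ne _ hab
      omega
  omega

theorem card_orbits_swap_mul_of_ne [Finite X] (f : Equiv.Perm X) {a b : X}
    (hab : (Quot.mk _ a : Orbits f) ≠ Quot.mk _ b) :
    Nat.card (Orbits (Equiv.swap a b * f)) + 1 = Nat.card (Orbits f) := by
  rw [← card_quot_insert_of_ne _ hab, ← card_orbits_insert_swap_mul,
    card_quot_insert_of_eq _ (orbit_swap_mul_eq f hab)]

end SwapMul

/-! ## Euler's formula for the subgraphs of a plane graph -/

/-- The permutation of the darts which reverses the edges in `S`. -/
def flip {E : Type*} [DecidableEq E] (S : Finset E) : Equiv.Perm (E × Bool) where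
  toFun d := (d.1, if d.1 ∈ S then !d.2 else d.2)
  invFun d := (d.1, if d.1 ∈ S then !d.2 else d.2)
  left_inv := by rintro ⟨e, b⟩; by_cases h : e ∈ S <;> simp [h]
  right_inv := by rintro ⟨e, b⟩; by_cases h : e ∈ S <;> simp [h]

theorem flip_apply {E : Type*} [DecidableEq E] (S : Finset E) (d : E × Bool) :
    flip S d = (d.1, if d.1 ∈ S then !d.2 else d.2) := rfl

theorem flip_empty {E : Type*} [DecidableEq E] : flip (∅ : Finset E) = 1 := by
  ext d <;> simp [flip_apply]

theorem flip_insert {E : Type*} [DecidableEq E] {S : Finset E} {e : E} (he : e ∉ S) :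
    flip (insert e S) = Equiv.swap (e, false) (e, true) * flip S := by
  refine Equiv.ext fun d => ?_
  obtain ⟨e', b⟩ := d
  rw [Equiv.Perm.mul_apply]
  simp only [flip_apply]
  by_cases h : e' = e
  · subst h
    cases b <;> simp [he]
  · rw [Equiv.swap_apply_of_ne_of_ne (by simp [h]) (by simp [h])]
    simp [h]

/-- The relation on the vertices generated by the edges in `S`, if the dart `d` is attached to
the vertex `vtx d`. -/
def EdgeRel {E V : Type*} (vtx : E × Bool → V) (S : Finset E) (x y : V) : Prop :=
  ∃ e ∈ S, x = vtx (e, false) ∧ y = vtx (e, true)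

section Euler

variable {E V : Type*} [DecidableEq E] (next : Equiv.Perm (E × Bool))
  (vtx : E × Bool → V)

/-- A walk around a face stays in one component: `next` keeps the vertex, and `flip S` either does
nothing or crosses an edge of `S`. -/
theorem vtx_eq_of_orbit_eq (hnext : ∀ d, vtx (next d) = vtx d) (S : Finset E)
    {d d' : E × Bool} (h : (Quot.mk _ d : Orbits (flip S * next)) = Quot.mk _ d') :
    Quot.mk (EdgeRel vtx S) (vtx d) = Quot.mk (EdgeRel vtx S) (vtx d') := by
  refine congrArg (Quot.lift (fun d => Quot.mk (EdgeRel vtx S) (vtx d)) ?_) h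
  rintro x y rfl
  rw [← hnext x, Equiv.Perm.mul_apply]
  generalize next x = z
  obtain ⟨e, b⟩ := z
  rw [flip_apply]
  by_cases he : e ∈ S
  · cases b
    · simpa [he] using Quot.sound (r := EdgeRel vtx S) ⟨e, he, rfl, rfl⟩
    · simpa [he] using (Quot.sound (r := EdgeRel vtx S) ⟨e, he, rfl, rfl⟩).symm
  · simp [he]

/-- The deviation from Euler's formula (twice the genus) does not decrease when an edge is
added. -/
theorem genus_le_insert [Finite E] [Finite V] (hnext : ∀ d, vtx (next d) = vtx d)
    {S : Finset E} {e : E} (he : e ∉ S) :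
    2 * Nat.card (Quot (EdgeRel vtx S)) + S.card + Nat.card (Orbits (flip (insert e S) * next)) ≤
      2 * Nat.card (Quot (EdgeRel vtx (insert e S))) + (insert e S).card +
        Nat.card (Orbits (flip S * next)) := by
  rw [Finset.card_insert_of_notMem he, flip_insert he, mul_assoc]
  have hk : Nat.card (Quot (EdgeRel vtx (insert e S))) = Nat.card (Quot fun x y =>
      EdgeRel vtx S x y ∨ (x = vtx (e, false) ∧ y = vtx (e, true))) := by
    congr 2
    ext x y
    simp only [EdgeRel, Finset.mem_insert, exists_eq_or_imp]
    exact or_comm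
  rw [hk]
  -- An edge within a component creates at most one face. An edge between two components joins two
  -- different faces, so components and faces both drop by one and the genus is unchanged.
  by_cases h : Quot.mk (EdgeRel vtx S) (vtx (e, false)) = Quot.mk (EdgeRel vtx S) (vtx (e, true))
  · rw [card_quot_insert_of_eq _ h]
    have := card_orbits_swap_mul_le (flip S * next) (e, false) (e, true)
    omega
  · have h1 := card_quot_insert_of_ne _ h
    have h2 := card_orbits_swap_mul_of_ne (flip S * next) (a := (e, false)) (b := (e, true))
      fun h' => h (vtx_eq_of_orbit_eq next vtx hnext S h')
    omega

theorem genus_le_union [Finite E] [Finite V] (hnext : ∀ d, vtx (next d) = vtx d)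
    (S T : Finset E) :
    2 * Nat.card (Quot (EdgeRel vtx S)) + S.card + Nat.card (Orbits (flip (S ∪ T) * next)) ≤
      2 * Nat.card (Quot (EdgeRel vtx (S ∪ T))) + (S ∪ T).card +
        Nat.card (Orbits (flip S * next)) := by
  induction T using Finset.induction_on with
  | empty => rw [Finset.union_empty]
  | insert e T he ih =>
    rw [Finset.union_insert]
    by_cases h : e ∈ S ∪ T
    · rwa [Finset.insert_eq_of_mem h]
    · have := genus_le_insert next vtx hnext h
      omega

/-- Euler's formula for all spanning subgraphs of a plane graph; `Orbits (flip S * next)` are the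
faces of the subgraph `S`, and `k` counts further vertices without edges. It is assumed that there
are not too many vertex cycles, and enough faces of the whole graph. -/
theorem card_faces_add [Fintype E] [Finite V] (hnext : ∀ d, vtx (next d) = vtx d) (k : ℕ)
    (hvert : Nat.card (Orbits next) + k ≤ Nat.card V)
    (hface : 2 * Nat.card (Quot (EdgeRel vtx Finset.univ)) + Fintype.card E ≤
      Nat.card (Orbits (flip Finset.univ * next)) + k + Nat.card V) (S : Finset E) :
    Nat.card (Orbits (flip S * next)) + k + Nat.card V =
      2 * Nat.card (Quot (EdgeRel vtx S)) + S.card := by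
  -- The quantity `2 * components + edges - faces` is monotone in the edge set. It is at least `|V|
  -- + k` for `∅` by `hvert` and at most `|V| + k` for all edges by `hface`, hence constant.
  have h1 := genus_le_union next vtx hnext ∅ S
  have h2 := genus_le_union next vtx hnext S Finset.univ
  have h0 : Nat.card (Quot (EdgeRel vtx (∅ : Finset E))) = Nat.card V :=
    Nat.card_congr
      { toFun := Quot.lift id (by rintro x y ⟨e, he, -⟩; simp at he)
        invFun := Quot.mk _
        left_inv := by rintro ⟨x⟩; rfl
        right_inv := fun x => rfl }
  rw [Finset.empty_union, flip_empty, one_mul, h0, Finset.card_empty] at h1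
  rw [Finset.union_eq_right.2 (Finset.subset_univ S), Finset.card_univ] at h2
  omega

end Euler

/-! ## The loops of the medial diagram -/

section Loops

variable {E : Type} [DecidableEq E] [Fintype E] (G : SignedMap E)

/-- The edges which are contracted in the state `s`. -/
def contracted (s : E → Bool) : Finset E := Finset.univ.filter fun e => s e ≠ G.positive e

/-- A loop alternates between arcs and smoothings. From the left end of `d`, the arc leads to the
right end of `next d`; the smoothing then leads to the left end of the same dart, or of the opposite
one if the edge is contracted. Together this is one step of the face permutation. -/
theorem card_medial_quot (s : E → Bool) :
    Nat.card (Quot fun x y : E × Bool × Bool =>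
      y = G.medialDiagram.glue x ∨ y = G.medialDiagram.smooth s x) =
      Nat.card (Orbits (flip (contracted G s) * G.next)) := by
  set r := fun x y : E × Bool × Bool =>
      y = G.medialDiagram.glue x ∨ y = G.medialDiagram.smooth s x with hr
  have hglue : ∀ d : E × Bool, G.medialDiagram.glue (d.1, d.2, !d.2) =
      ((G.next d).1, (G.next d).2, (G.next d).2) := by
    intro d
    simp [SignedMap.medialDiagram, SignedMap.medialGlue]
  have hglue' : ∀ d : E × Bool, G.medialDiagram.glue (d.1, d.2, d.2) =
      ((G.next.symm d).1, (G.next.symm d).2, !(G.next.symm d).2) := by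
    intro d
    have : ¬ d.2 = !d.2 := by cases d.2 <;> simp
    simp [SignedMap.medialDiagram, SignedMap.medialGlue]
  have hsmooth : ∀ d : E × Bool, G.medialDiagram.smooth s (d.1, d.2, d.2) =
      ((flip (contracted G s) d).1, (flip (contracted G s) d).2,
        !(flip (contracted G s) d).2) := by
    rintro ⟨e, b⟩
    by_cases h : s e = G.positive e <;>
      simp [SignedMap.medialDiagram, LinkDiagram.smooth, flip_apply, contracted, h]
  have hsmooth' : ∀ d : E × Bool, G.medialDiagram.smooth s (d.1, d.2, !d.2) =
      ((flip (contracted G s) d).1, (flip (contracted G s) d).2,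
        (flip (contracted G s) d).2) := by
    rintro ⟨e, b⟩
    by_cases h : s e = G.positive e <;>
      simp [SignedMap.medialDiagram, LinkDiagram.smooth, flip_apply, contracted, h]
  have hflip : ∀ d, flip (contracted G s) (flip (contracted G s) d) = d :=
    (flip (contracted G s)).left_inv
  refine Nat.card_congr
    -- A left end represents its own dart; a right end is glued to the left end of the preceding
    -- dart and represents that one.
    { toFun := Quot.lift (fun x => if x.2.2 = !x.2.1 then Quot.mk _ (x.1, x.2.1)
        else Quot.mk _ (G.next.symm (x.1, x.2.1))) ?_
      invFun := Quot.lift (fun d => Quot.mk _ (d.1, d.2, !d.2)) ?_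
      left_inv := ?_
      right_inv := ?_ }
  · have cases_end : ∀ x : E × Bool × Bool,
        (∃ d : E × Bool, x = (d.1, d.2, !d.2)) ∨ ∃ d : E × Bool, x = (d.1, d.2, d.2) := by
      rintro ⟨e, b, n⟩
      by_cases h : n = !b
      · exact Or.inl ⟨(e, b), by simp [h]⟩
      · refine Or.inr ⟨(e, b), ?_⟩
        cases n <;> cases b <;> simp_all
    intro x y hxy
    rcases cases_end x with ⟨d, rfl⟩ | ⟨d, rfl⟩
    · rcases hxy with rfl | rfl
      · rw [hglue]
        simp
        rfl
      · rw [hsmooth']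
        simp only [Bool.eq_not_self, if_true, if_false, Prod.mk.eta]
        rw [← orbit_apply _ (G.next.symm _)]
        simp [hflip]
        rfl
    · rcases hxy with rfl | rfl
      · rw [hglue']
        simp
        rfl
      · rw [hsmooth]
        simp only [Bool.eq_not_self, if_true, if_false, Prod.mk.eta]
        rw [← orbit_apply _ (G.next.symm _)]
        simp
        rfl
  · rintro d _ rfl
    have h1 : (Quot.mk r (d.1, d.2, !d.2)) = Quot.mk r _ := Quot.sound (Or.inl rfl)
    have h2 : (Quot.mk r ((G.next d).1, (G.next d).2, (G.next d).2)) = Quot.mk r _ :=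
      Quot.sound (Or.inr rfl)
    rw [h1, hglue, h2, hsmooth, Equiv.Perm.mul_apply]
  · rintro ⟨e, b, n⟩
    by_cases h : n = !b
    · simp [h]
    · obtain rfl : n = b := by cases n <;> cases b <;> simp_all
      have h1 : (Quot.mk r (e, n, n)) = Quot.mk r _ := Quot.sound (Or.inl rfl)
      simp only [h, if_false]
      rw [h1, hglue' (e, n)]
  · rintro ⟨d⟩
    simp
    rfl

theorem loops_medialDiagram (s : E → Bool) :
    G.medialDiagram.loops s =
      Nat.card (Orbits (flip (contracted G s) * G.next)) + G.isolated := by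
  rw [LinkDiagram.loops, card_medial_quot]
  rfl

end Loops

/-! ## The half-graph of a tree -/

/-- The initial vertex of the edge of a caret: the first leaf below the caret. -/
def firstLeaf : (T : BinaryTree Unit) → Caret T → ℕ
  | .node _ _ _, none => 0
  | .node _ l _, some (.inl c) => firstLeaf l c
  | .node _ l r, some (.inr c) => l.numLeaves + firstLeaf r c

/-- The final vertex of the edge of a caret: the first leaf below its right child. -/
def midLeaf : (T : BinaryTree Unit) → Caret T → ℕ
  | .node _ l _, none => l.numLeaves
  | .node _ l _, some (.inl c) => midLeaf l c
  | .node _ l r, some (.inr c) => l.numLeaves + midLeaf r c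

/-- The number of the first leaf behind those below a caret. -/
def endLeaf : (T : BinaryTree Unit) → Caret T → ℕ
  | .node _ l r, none => l.numLeaves + r.numLeaves
  | .node _ l _, some (.inl c) => endLeaf l c
  | .node _ l r, some (.inr c) => l.numLeaves + endLeaf r c

theorem firstLeaf_lt : ∀ (T : BinaryTree Unit) (c : Caret T), firstLeaf T c < T.numLeaves
  | .node _ l r, none => by
      have := l.numLeaves_pos
      simp only [firstLeaf, BinaryTree.numLeaves]
      omega
  | .node _ l r, some (.inl c) => by
      have := firstLeaf_lt l c
      simp only [firstLeaf, BinaryTree.numLeaves]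
      omega
  | .node _ l r, some (.inr c) => by
      have := firstLeaf_lt r c
      simp only [firstLeaf, BinaryTree.numLeaves]
      omega

theorem midLeaf_lt : ∀ (T : BinaryTree Unit) (c : Caret T), midLeaf T c < T.numLeaves
  | .node _ l r, none => by
      have := r.numLeaves_pos
      simp only [midLeaf, BinaryTree.numLeaves]
      omega
  | .node _ l r, some (.inl c) => by
      have := midLeaf_lt l c
      simp only [midLeaf, BinaryTree.numLeaves]
      omega
  | .node _ l r, some (.inr c) => by
      have := midLeaf_lt r c
      simp only [midLeaf, BinaryTree.numLeaves]
      omega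

theorem exists_midLeaf_eq : ∀ (T : BinaryTree Unit) {v : ℕ}, 0 < v → v < T.numLeaves →
    ∃ c, midLeaf T c = v
  | .nil, v, h0, h => by simp at h; omega
  | .node _ l r, v, h0, h => by
      simp only [BinaryTree.numLeaves] at h
      rcases lt_trichotomy v l.numLeaves with hv | rfl | hv
      · obtain ⟨c, hc⟩ := exists_midLeaf_eq l h0 hv
        exact ⟨some (.inl c), hc⟩
      · exact ⟨none, rfl⟩
      · obtain ⟨c, hc⟩ := exists_midLeaf_eq r (v := v - l.numLeaves) (by omega) (by omega)
        exact ⟨some (.inr c), by simp only [midLeaf]; omega⟩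

theorem exists_endLeaf_eq : ∀ {T : BinaryTree Unit}, 1 < T.numLeaves →
    ∃ c, endLeaf T c = T.numLeaves
  | .nil, h => by simp at h
  | .node _ _ _, _ => ⟨none, rfl⟩

/-- The half-graph of a tree is connected. -/
theorem eq_zero_of_caret_invariant {α : Type*} : ∀ (T : BinaryTree Unit) (f : ℕ → α),
    (∀ c, f (firstLeaf T c) = f (midLeaf T c)) → ∀ v < T.numLeaves, f v = f 0
  | .nil, f, _, v, hv => by
      simp at hv
      rw [hv]
  | .node _ l r, f, hf, v, hv => by
      simp only [BinaryTree.numLeaves] at hv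
      by_cases h : v < l.numLeaves
      · exact eq_zero_of_caret_invariant l f (fun c => hf (some (.inl c))) v h
      · have h1 := eq_zero_of_caret_invariant r (fun i => f (l.numLeaves + i))
          (fun c => hf (some (.inr c))) (v - l.numLeaves) (by omega)
        simp only [Nat.add_sub_cancel' (not_lt.1 h)] at h1
        rw [h1]
        exact (hf none).symm

theorem card_caret_add_one : ∀ T : BinaryTree Unit, Fintype.card (Caret T) + 1 = T.numLeaves
  | .nil => by
      simp only [BinaryTree.numLeaves]
      exact congrArg (· + 1) (Fintype.card_eq_zero (α := Empty))
  | .node _ l r => by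
      have h : Fintype.card (Caret (.node () l r)) = Fintype.card (Option (Caret l ⊕ Caret r)) :=
        Fintype.card_congr (Equiv.refl _)
      have hl := card_caret_add_one l
      have hr := card_caret_add_one r
      rw [h, Fintype.card_option, Fintype.card_sum, BinaryTree.numLeaves]
      omega

/-- The vertex of a dart of the half-graph. -/
def dartVertex (T : BinaryTree Unit) (d : Caret T × Bool) : ℕ :=
  if d.2 then midLeaf T d.1 else firstLeaf T d.1

/-- The darts of the root caret. -/
def rootDart (l r : BinaryTree Unit) (b : Bool) : Caret (.node () l r) × Bool := (none, b)

/-- The darts in the left subtree. -/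
def leftDart (l r : BinaryTree Unit) (d : Caret l × Bool) : Caret (.node () l r) × Bool :=
  (some (.inl d.1), d.2)

/-- The darts in the right subtree. -/
def rightDart (l r : BinaryTree Unit) (d : Caret r × Bool) : Caret (.node () l r) × Bool :=
  (some (.inr d.1), d.2)

theorem leftDart_injective (l r : BinaryTree Unit) : Function.Injective (leftDart l r) := by
  intro d d' h
  have h1 := Sum.inl.inj (Option.some.inj (congrArg Prod.fst h))
  exact Prod.ext h1 (congrArg (fun x => x.2) h :)

theorem rightDart_injective (l r : BinaryTree Unit) : Function.Injective (rightDart l r) := by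
  intro d d' h
  have h1 := Sum.inr.inj (Option.some.inj (congrArg Prod.fst h))
  exact Prod.ext h1 (congrArg (fun x => x.2) h :)

theorem leftDart_ne_rootDart (l r : BinaryTree Unit) (d : Caret l × Bool) (b : Bool) :
    leftDart l r d ≠ rootDart l r b :=
  fun h => Option.some_ne_none _ (congrArg Prod.fst h)

theorem rightDart_ne_rootDart (l r : BinaryTree Unit) (d : Caret r × Bool) (b : Bool) :
    rightDart l r d ≠ rootDart l r b :=
  fun h => Option.some_ne_none _ (congrArg Prod.fst h)

theorem leftDart_ne_rightDart (l r : BinaryTree Unit) (d : Caret l × Bool) (d' : Caret r × Bool) :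
    leftDart l r d ≠ rightDart l r d' :=
  fun h => Sum.inl_ne_inr (Option.some.inj (congrArg Prod.fst h))

theorem rootDart_inj (l r : BinaryTree Unit) {b b' : Bool} :
    rootDart l r b = rootDart l r b' ↔ b = b' :=
  ⟨fun h => (congrArg (fun x => x.2) h :), fun h => h ▸ rfl⟩

theorem dart_cases (l r : BinaryTree Unit) (d : Caret (.node () l r) × Bool) :
    (∃ b, d = rootDart l r b) ∨ (∃ d', d = leftDart l r d') ∨ ∃ d', d = rightDart l r d' :=
  match d with
  | (none, b) => Or.inl ⟨b, rfl⟩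
  | (some (.inl c), b) => Or.inr (Or.inl ⟨(c, b), rfl⟩)
  | (some (.inr c), b) => Or.inr (Or.inr ⟨(c, b), rfl⟩)

theorem dartVertex_lt (T : BinaryTree Unit) (d : Caret T × Bool) :
    dartVertex T d < T.numLeaves := by
  unfold dartVertex
  split_ifs
  · exact midLeaf_lt T d.1
  · exact firstLeaf_lt T d.1

theorem dartVertex_rootDart (l r : BinaryTree Unit) (b : Bool) :
    dartVertex _ (rootDart l r b) = if b then l.numLeaves else 0 := rfl

theorem dartVertex_leftDart (l r : BinaryTree Unit) (d : Caret l × Bool) :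
    dartVertex _ (leftDart l r d) = dartVertex l d := rfl

theorem dartVertex_rightDart (l r : BinaryTree Unit) (d : Caret r × Bool) :
    dartVertex _ (rightDart l r d) = l.numLeaves + dartVertex r d := by
  obtain ⟨c, b⟩ := d
  cases b <;> rfl

theorem fan_node_of_lt (l r : BinaryTree Unit) {v : ℕ} (hv : v < l.numLeaves) :
    fan (.node () l r) v =
      (fan l v).map (leftDart l r) ++ if v = 0 then [rootDart l r false] else [] :=
  if_pos hv

theorem fan_node_of_not_lt (l r : BinaryTree Unit) {v : ℕ} (hv : ¬ v < l.numLeaves) :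
    fan (.node () l r) v = (fan r (v - l.numLeaves)).map (rightDart l r) ++
      if v = l.numLeaves then [rootDart l r true] else [] :=
  if_neg hv

/-- The fans partition the darts by vertices, which makes the vertex cycles of the pair graph
disjoint. -/
theorem mem_fan : ∀ (T : BinaryTree Unit) (v : ℕ) (d : Caret T × Bool),
    d ∈ fan T v ↔ dartVertex T d = v
  | .nil, _, ⟨c, _⟩ => nomatch c
  | .node () l r, v, d => by
      have hl := l.numLeaves_pos
      by_cases hv : v < l.numLeaves
      · rw [fan_node_of_lt l r hv, List.mem_append]
        have hroot : d ∈ (if v = 0 then [rootDart l r false] else []) ↔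
            v = 0 ∧ d = rootDart l r false := by
          split_ifs with h <;> simp [h]
        rw [hroot, List.mem_map]
        rcases dart_cases l r d with ⟨b, rfl⟩ | ⟨d, rfl⟩ | ⟨d, rfl⟩
        · rw [dartVertex_rootDart]
          cases b
          · simp [leftDart_ne_rootDart, eq_comm]
          · simp [leftDart_ne_rootDart, rootDart_inj]
            omega
        · simp only [leftDart_ne_rootDart, (leftDart_injective l r).eq_iff, dartVertex_leftDart,
            exists_eq_right, and_false, or_false]
          exact mem_fan l v d
        · simp only [rightDart_ne_rootDart, leftDart_ne_rightDart, dartVertex_rightDart,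
            and_false, or_false, exists_false, false_iff]
          omega
      · rw [fan_node_of_not_lt l r hv, List.mem_append]
        have hroot : d ∈ (if v = l.numLeaves then [rootDart l r true] else []) ↔
            v = l.numLeaves ∧ d = rootDart l r true := by
          split_ifs with h <;> simp [h]
        rw [hroot, List.mem_map]
        rcases dart_cases l r d with ⟨b, rfl⟩ | ⟨d, rfl⟩ | ⟨d, rfl⟩
        · rw [dartVertex_rootDart]
          cases b
          · simp [rightDart_ne_rootDart, rootDart_inj]
            omega
          · simp [rightDart_ne_rootDart, eq_comm]
        · have := dartVertex_lt l d
          simp only [(leftDart_ne_rightDart _ _ _ _).symm, leftDart_ne_rootDart,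
            dartVertex_leftDart, and_false, or_false, exists_false, false_iff]
          omega
        · simp only [rightDart_ne_rootDart, (rightDart_injective l r).eq_iff,
            dartVertex_rightDart, exists_eq_right, and_false, or_false]
          rw [mem_fan r _ d]
          omega

theorem nodup_fan : ∀ (T : BinaryTree Unit) (v : ℕ), (fan T v).Nodup
  | .nil, _ => List.nodup_nil
  | .node () l r, v => by
      by_cases hv : v < l.numLeaves
      · rw [fan_node_of_lt l r hv]
        refine List.Nodup.append ((nodup_fan l v).map (leftDart_injective l r)) ?_ ?_
        · split_ifs <;> simp
        · split_ifs <;> simp [leftDart_ne_rootDart]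
      · rw [fan_node_of_not_lt l r hv]
        refine List.Nodup.append ((nodup_fan r _).map (rightDart_injective l r)) ?_ ?_
        · split_ifs <;> simp
        · split_ifs <;> simp [rightDart_ne_rootDart]

/-! ## Label paths -/

/-- The list `l` leads from `x` to `y`, if an element `d` leads from `R d` to `L d`. -/
def LabelPath {D M : Type*} (R L : D → M) : M → List D → M → Prop
  | x, [], y => x = y
  | x, d :: l, y => R d = x ∧ LabelPath R L (L d) l y

section LabelPath

variable {D D' M M' : Type*} {R L : D → M}

theorem LabelPath.append {x y z : M} {l l' : List D} (h : LabelPath R L x l y)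
    (h' : LabelPath R L y l' z) : LabelPath R L x (l ++ l') z := by
  induction l generalizing x with
  | nil =>
    obtain rfl : x = y := h
    exact h'
  | cons d l ih => exact ⟨h.1, ih h.2⟩

theorem LabelPath.map {R' L' : D' → M'} {f : D → D'} {g : M → M'} (hR : ∀ d, R' (f d) = g (R d))
    (hL : ∀ d, L' (f d) = g (L d)) {x y : M} {l : List D} (h : LabelPath R L x l y) :
    LabelPath R' L' (g x) (l.map f) (g y) := by
  induction l generalizing x with
  | nil => exact congrArg g h
  | cons d l ih =>
    refine ⟨(hR d).trans (congrArg g h.1), ?_⟩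
    rw [hL]
    exact ih h.2

theorem LabelPath.reverse {x y : M} {l : List D} (h : LabelPath R L x l y) :
    LabelPath L R y l.reverse x := by
  induction l generalizing x with
  | nil => exact Eq.symm h
  | cons d l ih =>
    rw [List.reverse_cons]
    exact (ih h.2).append ⟨rfl, h.1⟩

theorem LabelPath.label_getElem_succ {x y : M} {l : List D} (h : LabelPath R L x l y) (i : ℕ)
    (hi : i + 1 < l.length) : R l[i + 1] = L l[i] := by
  induction l generalizing x i with
  | nil => simp at hi
  | cons d l ih =>
    cases i with
    | zero =>
      match l, h, hi with
      | e :: l, h, _ => exact h.2.1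
    | succ i => exact ih h.2 i (by simpa using hi)

theorem LabelPath.label_last {x y : M} {l : List D} (h : LabelPath R L x l y)
    (hl : 0 < l.length) : L l[l.length - 1] = y := by
  induction l generalizing x with
  | nil => simp at hl
  | cons d l ih =>
    cases l with
    | nil => exact h.2
    | cons e l => exact ih h.2 (by simp)

theorem LabelPath.label_head {x y : M} {l : List D} (h : LabelPath R L x l y)
    (hl : 0 < l.length) : R l[0] = x := by
  match l, h with
  | d :: l, h => exact h.1

/-- In a closed path each element continues its cyclic predecessor; closedness is what covers the
wrap from the last element to the first. -/
theorem LabelPath.label_formPerm [DecidableEq D] {x : M} {l : List D} (h : LabelPath R L x l x)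
    (hl : l.Nodup) {d : D} (hd : d ∈ l) : R (l.formPerm d) = L d := by
  obtain ⟨i, hi, rfl⟩ := List.getElem_of_mem hd
  rw [List.formPerm_apply_getElem l hl i hi]
  by_cases h1 : i + 1 < l.length
  · simp only [Nat.mod_eq_of_lt h1]
    exact h.label_getElem_succ i h1
  · obtain rfl : i = l.length - 1 := by omega
    have h2 : l.length - 1 + 1 = l.length := by omega
    simp only [h2, Nat.mod_self]
    rw [h.label_last (by omega), h.label_head (by omega)]

end LabelPath

/-- The face of the half-graph on the right of a dart; faces are numbered by the leaf behind
them. -/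
def rightFace (T : BinaryTree Unit) (d : Caret T × Bool) : ℕ :=
  if d.2 then endLeaf T d.1 else midLeaf T d.1

/-- The face of the half-graph on the left of a dart. -/
def leftFace (T : BinaryTree Unit) (d : Caret T × Bool) : ℕ :=
  if d.2 then midLeaf T d.1 else endLeaf T d.1

/-- Neighbouring darts share the face between them. The turn starts at the axis segment east of `v`,
in face `v + 1`, and ends at the segment to the west, in face `v`; west of vertex 0 lies the outer
face, whose number is that of all leaves. -/
theorem labelPath_fan : ∀ (T : BinaryTree Unit) (v : ℕ), v < T.numLeaves →
    LabelPath (rightFace T) (leftFace T) (v + 1) (fan T v) (if v = 0 then T.numLeaves else v)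
  | .nil, v, h => by
      obtain rfl : v = 0 := by simpa using h
      rfl
  | .node () l r, v, h => by
      simp only [BinaryTree.numLeaves] at h
      by_cases hv : v < l.numLeaves
      · have ih := (labelPath_fan l v hv).map (R' := rightFace (.node () l r))
          (L' := leftFace (.node () l r)) (f := leftDart l r) (g := id) (fun d => rfl)
          fun d => rfl
        rw [fan_node_of_lt l r hv]
        refine ih.append ?_
        -- At vertex 0 the root edge comes last and separates the outer face of `l` from that of the
        -- whole tree.
        by_cases h0 : v = 0
        · simp only [h0, if_true]
          exact ⟨rfl, rfl⟩
        · simp only [h0, if_false]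
          rfl
      · have hl := l.numLeaves_pos
        have ih := (labelPath_fan r (v - l.numLeaves) (by omega)).map
          (R' := rightFace (.node () l r))
          (L' := leftFace (.node () l r)) (f := rightDart l r)
          (g := fun i => l.numLeaves + i)
          (by rintro ⟨c, b⟩; cases b <;> rfl)
          (by rintro ⟨c, b⟩; cases b <;> rfl)
        rw [fan_node_of_not_lt l r hv]
        have h1 : l.numLeaves + (v - l.numLeaves + 1) = v + 1 := by omega
        rw [h1] at ih
        refine ih.append ?_
        -- At its right end the root edge leads from the outer face back to the face numbered `v`
        -- beneath it.
        by_cases h0 : v = l.numLeaves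
        · have h2 : l.numLeaves ≠ 0 := by omega
          simp only [h0, Nat.sub_self, if_true, if_neg h2]
          exact ⟨rfl, rfl⟩
        · have h2 : v ≠ 0 := by omega
          have h3 : v - l.numLeaves ≠ 0 := by omega
          simp only [if_neg h0, if_neg h2, if_neg h3, LabelPath]
          omega

/-! ## Vertices and faces of the graph of a pair of trees -/

section Star

variable (Tp Tm : BinaryTree Unit)

/-- The vertex to which a dart of the graph of a pair of trees is attached. -/
def pairVertex (d : (Caret Tp ⊕ Caret Tm) × Bool) : ℕ :=
  Sum.elim (fun c => dartVertex Tp (c, d.2)) (fun c => dartVertex Tm (c, d.2)) d.1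

theorem mem_star (v : ℕ) (d : (Caret Tp ⊕ Caret Tm) × Bool) :
    d ∈ star Tp Tm v ↔ pairVertex Tp Tm d = v := by
  obtain ⟨c | c, b⟩ := d
  · have h := mem_fan Tp v (c, b)
    simpa [star, pairVertex] using h
  · have h := mem_fan Tm v (c, b)
    simpa [star, pairVertex] using h

theorem nodup_star (v : ℕ) : (star Tp Tm v).Nodup := by
  refine List.Nodup.append ((nodup_fan Tp v).map ?_)
    (List.nodup_reverse.2 ((nodup_fan Tm v).map ?_)) ?_
  · rintro ⟨c, b⟩ ⟨c', b'⟩ h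
    simpa using h
  · rintro ⟨c, b⟩ ⟨c', b'⟩ h
    simpa using h
  · rw [List.disjoint_left]
    rintro ⟨c, b⟩ h h'
    simp at h h'
    grind

/-- The face on the right of a dart. -/
def pairRightFace (d : (Caret Tp ⊕ Caret Tm) × Bool) : ZMod Tp.numLeaves :=
  Sum.elim (fun c => (rightFace Tp (c, d.2) : ZMod Tp.numLeaves))
    -- Reflection into the lower half-plane exchanges left and right.
    (fun c => (leftFace Tm (c, d.2) : ZMod Tp.numLeaves)) d.1

/-- The face on the left of a dart. -/
def pairLeftFace (d : (Caret Tp ⊕ Caret Tm) × Bool) : ZMod Tp.numLeaves :=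
  Sum.elim (fun c => (leftFace Tp (c, d.2) : ZMod Tp.numLeaves))
    (fun c => (rightFace Tm (c, d.2) : ZMod Tp.numLeaves)) d.1

theorem pairLeftFace_reverse (c : Caret Tp ⊕ Caret Tm) (b : Bool) :
    pairLeftFace Tp Tm (c, !b) = pairRightFace Tp Tm (c, b) := by
  rcases c with c | c <;> cases b <;> rfl

variable {Tp Tm}

/-- The upper fan leads from face `v + 1` to face `v`, and the reversed lower fan leads back. Labels
are taken modulo `n` because the outer face, numbered `n`, plays the part of face 0 at the vertex 0.
-/
theorem labelPath_star (h : Tp.numLeaves = Tm.numLeaves) {v : ℕ}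
    (hv : v < Tp.numLeaves) :
    LabelPath (pairRightFace Tp Tm) (pairLeftFace Tp Tm) ((v + 1 : ℕ) : ZMod Tp.numLeaves)
      (star Tp Tm v) ((v + 1 : ℕ) : ZMod Tp.numLeaves) := by
  have hcast : (((if v = 0 then Tp.numLeaves else v) : ℕ) : ZMod Tp.numLeaves) = v := by
    split_ifs with h0
    · simp [h0]
    · rfl
  have h1 := (labelPath_fan Tp v hv).map (R' := pairRightFace Tp Tm) (L' := pairLeftFace Tp Tm)
    (f := fun d : Caret Tp × Bool => (Sum.inl d.1, d.2)) (g := Nat.cast) (fun d => rfl) fun d => rfl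
  have h2 := (labelPath_fan Tm v (h ▸ hv)).reverse.map (R' := pairRightFace Tp Tm)
    (L' := pairLeftFace Tp Tm) (f := fun d : Caret Tm × Bool => (Sum.inr d.1, d.2)) (g := Nat.cast)
    (fun d => rfl) fun d => rfl
  rw [hcast] at h1
  rw [← h, hcast, List.map_reverse] at h2
  exact h1.append h2

/-- The product of the cyclic permutations of disjoint lists. -/
theorem prod_formPerm_apply {D : Type*} [DecidableEq D] {s : ℕ → List D} {vtx : D → ℕ}
    (hs : ∀ v d, d ∈ s v ↔ vtx d = v) (d : D) : ∀ l : List ℕ, l.Nodup →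
    ((l.map fun v => (s v).formPerm).prod) d =
      if vtx d ∈ l then (s (vtx d)).formPerm d else d
  | [], _ => rfl
  | u :: l, hl => by
      rw [List.map_cons, List.prod_cons, Equiv.Perm.mul_apply,
        prod_formPerm_apply hs d l (List.nodup_cons.1 hl).2]
      by_cases hu : vtx d = u
      · subst hu
        rw [if_neg (List.nodup_cons.1 hl).1, if_pos List.mem_cons_self]
      · have hmem : vtx d ∈ u :: l ↔ vtx d ∈ l := by simp [hu]
        simp only [hmem]
        split_ifs
        · refine List.formPerm_apply_of_notMem fun h => hu ?_
          have h1 := List.formPerm_apply_mem_of_mem ((hs (vtx d) d).2 rfl)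
          rw [hs] at h h1
          exact h1.symm.trans h
        · exact List.formPerm_apply_of_notMem fun h => hu ((hs u d).1 h)

theorem pairVertex_lt (h : Tp.numLeaves = Tm.numLeaves) 
    (d : (Caret Tp ⊕ Caret Tm) × Bool) : pairVertex Tp Tm d < Tp.numLeaves := by
  obtain ⟨c | c, b⟩ := d
  · exact dartVertex_lt Tp (c, b)
  · exact h ▸ dartVertex_lt Tm (c, b)

theorem gammaGraph_next_apply (h : Tp.numLeaves = Tm.numLeaves) (d : (Caret Tp ⊕ Caret Tm) × Bool) :
    (gammaGraph Tp Tm).next d = (star Tp Tm (pairVertex Tp Tm d)).formPerm d := by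
  have := prod_formPerm_apply (mem_star Tp Tm) d (List.range Tp.numLeaves) List.nodup_range
  rw [if_pos (List.mem_range.2 (pairVertex_lt h d))] at this
  exact this

theorem pairVertex_next (h : Tp.numLeaves = Tm.numLeaves) (d : (Caret Tp ⊕ Caret Tm) × Bool) :
    pairVertex Tp Tm ((gammaGraph Tp Tm).next d) = pairVertex Tp Tm d := by
  rw [gammaGraph_next_apply h, ← mem_star]
  exact List.formPerm_apply_mem_of_mem ((mem_star _ _ _ _).2 rfl)

theorem pairRightFace_next (h : Tp.numLeaves = Tm.numLeaves) (d : (Caret Tp ⊕ Caret Tm) × Bool) :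
    pairRightFace Tp Tm ((gammaGraph Tp Tm).next d) = pairLeftFace Tp Tm d := by
  rw [gammaGraph_next_apply h]
  exact (labelPath_star h (pairVertex_lt h d)).label_formPerm (nodup_star _ _ _)
    ((mem_star _ _ _ _).2 rfl)

theorem orbit_eq_of_pairVertex_eq (h : Tp.numLeaves = Tm.numLeaves)
    {d d' : (Caret Tp ⊕ Caret Tm) × Bool}
    (hd : pairVertex Tp Tm d = pairVertex Tp Tm d') :
    (Quot.mk _ d : Orbits (gammaGraph Tp Tm).next) = Quot.mk _ d' := by
  set l := star Tp Tm (pairVertex Tp Tm d) with hl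
  have hnext : ∀ k : ℕ, ((gammaGraph Tp Tm).next ^ k) d = (l.formPerm ^ k) d ∧
      pairVertex Tp Tm ((l.formPerm ^ k) d) = pairVertex Tp Tm d := by
    intro k
    induction k with
    | zero => exact ⟨rfl, rfl⟩
    | succ k ih =>
      have h1 : ((gammaGraph Tp Tm).next ^ (k + 1)) d = (l.formPerm ^ (k + 1)) d := by
        rw [pow_succ', Equiv.Perm.mul_apply, ih.1, gammaGraph_next_apply h, ih.2, pow_succ',
          Equiv.Perm.mul_apply]
      refine ⟨h1, ?_⟩
      rw [← h1, pow_succ', Equiv.Perm.mul_apply, pairVertex_next h, ih.1, ih.2]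
  have hdl : d ∈ l := (mem_star _ _ _ _).2 rfl
  have hdl' : d' ∈ l := (mem_star _ _ _ _).2 hd.symm
  obtain ⟨i, hi, hi'⟩ := List.getElem_of_mem hdl
  obtain ⟨j, hj, hj'⟩ := List.getElem_of_mem hdl'
  -- Moving from position `i` to position `j` cyclically; the added length avoids a negative
  -- exponent.
  have hpow : (l.formPerm ^ (j + (l.length - i))) d = d' := by
    rw [← hi', List.formPerm_pow_apply_getElem l (nodup_star _ _ _)]
    have : i + (j + (l.length - i)) = j + l.length := by omega
    simp only [this, Nat.add_mod_right, Nat.mod_eq_of_lt hj, hj']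
  rw [← orbit_pow_apply _ d (j + (l.length - i)), (hnext _).1, hpow]

/-- An empty fan would be a label path without steps, forcing `v + 1 = v`, or `n = 1` at the vertex
0. -/
theorem isolated_eq_zero (h : Tp.numLeaves = Tm.numLeaves) (h1 : 1 < Tp.numLeaves) :
    (gammaGraph Tp Tm).isolated = 0 := by
  refine List.length_eq_zero_iff.2 (List.filter_eq_nil_iff.2 fun v hv he => ?_)
  have hv' := List.mem_range.1 hv
  have hf : fan Tp v = [] := by
    have := List.isEmpty_iff.1 he
    simp only [star, List.append_eq_nil_iff, List.map_eq_nil_iff] at this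
    exact this.1
  have := labelPath_fan Tp v hv'
  rw [hf] at this
  simp only [LabelPath] at this
  split_ifs at this <;> omega

/-- The vertex of a dart as an element of `Fin n`. -/
def pairVertexFin (h : Tp.numLeaves = Tm.numLeaves)
    (d : (Caret Tp ⊕ Caret Tm) × Bool) : Fin Tp.numLeaves :=
  ⟨pairVertex Tp Tm d, pairVertex_lt h d⟩

/-- The upper half-graph alone already connects all vertices. -/
theorem card_components_le_one (h : Tp.numLeaves = Tm.numLeaves) :
    Nat.card (Quot (EdgeRel (pairVertexFin h) Finset.univ)) ≤ 1 := by
  have h0 := Tp.numLeaves_pos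
  have key : ∀ v : Fin Tp.numLeaves, Quot.mk (EdgeRel (pairVertexFin h) Finset.univ) v =
      Quot.mk _ ⟨0, h0⟩ := by
    intro v
    have := eq_zero_of_caret_invariant Tp
      (fun i => if hi : i < Tp.numLeaves then
        Quot.mk (EdgeRel (pairVertexFin h) Finset.univ) ⟨i, hi⟩ else Quot.mk _ ⟨0, h0⟩)
      (fun c => by
        rw [dif_pos (firstLeaf_lt Tp c), dif_pos (midLeaf_lt Tp c)]
        exact Quot.sound ⟨Sum.inl c, Finset.mem_univ _, rfl, rfl⟩) v v.2
    simpa [h0] using this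
  have : Subsingleton (Quot (EdgeRel (pairVertexFin h) Finset.univ)) :=
    ⟨by rintro ⟨x⟩ ⟨y⟩; rw [key x, key y]⟩
  exact Finite.card_le_one_iff_subsingleton.2 this

/-- The left label is constant along a face walk, and every residue occurs: a nonzero one beneath
the caret whose right child starts at that leaf, and zero above the root caret. -/
theorem numLeaves_le_card_faces (h : Tp.numLeaves = Tm.numLeaves)
    (h1 : 1 < Tp.numLeaves) :
    Tp.numLeaves ≤ Nat.card (Orbits (flip Finset.univ * (gammaGraph Tp Tm).next)) := by
  have : NeZero Tp.numLeaves := ⟨by omega⟩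
  let f : Orbits (flip Finset.univ * (gammaGraph Tp Tm).next) → ZMod Tp.numLeaves :=
    Quot.lift (pairLeftFace Tp Tm) (by
      rintro d _ rfl
      rw [← pairRightFace_next h, Equiv.Perm.mul_apply, flip_apply, if_pos (Finset.mem_univ _),
        pairLeftFace_reverse])
  have hf : Function.Surjective f := by
    intro x
    by_cases hx : x.val = 0
    · obtain ⟨c, hc⟩ := exists_endLeaf_eq h1
      refine ⟨Quot.mk _ (Sum.inl c, false), ?_⟩
      change ((endLeaf Tp c : ℕ) : ZMod Tp.numLeaves) = x
      rw [hc, ZMod.natCast_self, (ZMod.val_eq_zero x).1 hx]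
    · obtain ⟨c, hc⟩ := exists_midLeaf_eq Tp (Nat.pos_of_ne_zero hx) (ZMod.val_lt x)
      refine ⟨Quot.mk _ (Sum.inl c, true), ?_⟩
      change ((midLeaf Tp c : ℕ) : ZMod Tp.numLeaves) = x
      rw [hc, ZMod.natCast_zmod_val]
  have := Nat.card_le_card_of_surjective f hf
  rwa [Nat.card_zmod] at this

theorem card_faces_gammaGraph (h : Tp.numLeaves = Tm.numLeaves)
    (S : Finset (Caret Tp ⊕ Caret Tm)) :
    Nat.card (Orbits (flip S * (gammaGraph Tp Tm).next)) + (gammaGraph Tp Tm).isolated +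
      Tp.numLeaves = 2 * Nat.card (Quot (EdgeRel (pairVertexFin h) S)) + S.card := by
  have hk := card_components_le_one h
  have hcp := card_caret_add_one Tp
  have hcm := card_caret_add_one Tm
  have hnext : ∀ d, pairVertexFin h ((gammaGraph Tp Tm).next d) = pairVertexFin h d :=
    fun d => Fin.ext (pairVertex_next h d)
  have hinj : Nat.card (Orbits (gammaGraph Tp Tm).next) ≤ Tp.numLeaves := by
    rw [← Nat.card_fin Tp.numLeaves]
    refine Nat.card_le_card_of_injective
      (Quot.lift (pairVertexFin h) (by rintro d _ rfl; exact (hnext d).symm)) ?_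
    rintro ⟨d⟩ ⟨d'⟩ hd
    exact orbit_eq_of_pairVertex_eq h (congrArg Fin.val hd)
  have key := card_faces_add (gammaGraph Tp Tm).next (pairVertexFin h) hnext
    (gammaGraph Tp Tm).isolated
  rw [Nat.card_fin, Fintype.card_sum] at key
  by_cases h1 : 1 < Tp.numLeaves
  · rw [isolated_eq_zero h h1] at key ⊢
    have := numLeaves_le_card_faces h h1
    exact key (by omega) (by omega) S
  -- With one leaf there are no darts, so the only vertex and its only face are both accounted for
  -- by `isolated`.
  · have h1' := Tp.numLeaves_pos
    have hE : IsEmpty (Caret Tp ⊕ Caret Tm) := by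
      rw [← Fintype.card_eq_zero_iff, Fintype.card_sum]
      omega
    have hO : Nat.card (Orbits (gammaGraph Tp Tm).next) = 0 := by
      have : IsEmpty (Orbits (gammaGraph Tp Tm).next) := ⟨by rintro ⟨d⟩; exact hE.elim d.1⟩
      exact Nat.card_of_isEmpty
    have hiso : (gammaGraph Tp Tm).isolated = 1 := by
      have hn : Tp.numLeaves = 1 := by omega
      have hs : star Tp Tm 0 = [] := List.eq_nil_iff_forall_not_mem.2 fun d => hE.elim d.1
      simp [gammaGraph, hn, hs]
    exact key (by omega) (by omega) S

end Star

/-! ## The bracket as a partition function of a Potts model -/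

/-- The Boltzmann weight of an edge with spins `x` and `y` at its ends. -/
noncomputable def edgeWeight (A d : ℂ) {q : ℕ} (x y : Fin q) : ℂ :=
  A + if x = y then A⁻¹ * d else 0

/-- Colourings that agree across every edge of `S` are the same as functions on the components. -/
theorem card_pow_components {V E : Type*} [Fintype V] [DecidableEq V] (q : ℕ)
    (vtx : E × Bool → V) (S : Finset E) :
    (q : ℂ) ^ Nat.card (Quot (EdgeRel vtx S)) =
      ∑ σ : V → Fin q, ∏ e ∈ S, if σ (vtx (e, false)) = σ (vtx (e, true)) then 1 else 0 := by
  classical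
  have e : (Quot (EdgeRel vtx S) → Fin q) ≃
      {σ : V → Fin q // ∀ e ∈ S, σ (vtx (e, false)) = σ (vtx (e, true))} :=
    { toFun := fun τ => ⟨fun v => τ (Quot.mk _ v), fun e he =>
        congrArg τ (Quot.sound ⟨e, he, rfl, rfl⟩)⟩
      invFun := fun σ => Quot.lift σ.1 (by rintro _ _ ⟨e, he, rfl, rfl⟩; exact σ.2 e he)
      left_inv := by
        intro τ
        ext ⟨v⟩
        rfl
      right_inv := fun σ => rfl }
  have h1 : q ^ Nat.card (Quot (EdgeRel vtx S)) = Fintype.card {σ : V → Fin q //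
      ∀ e ∈ S, σ (vtx (e, false)) = σ (vtx (e, true))} := by
    rw [← Nat.card_eq_fintype_card, ← Nat.card_congr e, Nat.card_fun, Nat.card_fin]
  rw [← Nat.cast_pow, h1, Fintype.card_subtype, Finset.card_filter]
  push_cast
  refine Finset.sum_congr rfl fun σ _ => ?_
  rw [Finset.prod_ite_zero]
  simp

theorem zpow_sum_eq_prod {ι : Type*} {A : ℂ} (hA : A ≠ 0) (s : Finset ι) (f : ι → ℤ) :
    A ^ (∑ i ∈ s, f i) = ∏ i ∈ s, A ^ f i := by
  classical
  induction s using Finset.induction_on with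
  | empty => simp
  | insert i s hi ih => rw [Finset.sum_insert hi, Finset.prod_insert hi, zpow_add₀ hA, ih]

/-- This is the Fortuin–Kasteleyn expansion read backwards: by Euler's formula a state contributes
`q ^ components * d ^ edges`. Writing the first factor as a sum over spins makes the contribution a
product over edges, so the sum over states factorizes. -/
theorem kauffmanBracket_medialDiagram {E V : Type} [Fintype E] [DecidableEq E] [Fintype V]
    [DecidableEq V] (G : SignedMap E) (vtx : E × Bool → V)
    (hG : ∀ S : Finset E, Nat.card (Orbits (flip S * G.next)) + G.isolated + Fintype.card V =
      2 * Nat.card (Quot (EdgeRel vtx S)) + S.card)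
    {A d : ℂ} (hA : A ≠ 0) (hd : d ≠ 0) (hAd : -A ^ 2 - A ^ (-2 : ℤ) = d) {q : ℕ}
    (hq : d ^ 2 = q) :
    G.medialDiagram.kauffmanBracket A * d ^ (Fintype.card V + 1) =
      ∑ σ : V → Fin q, ∏ e, edgeWeight (if G.positive e then A else A⁻¹) d
        (σ (vtx (e, false))) (σ (vtx (e, true))) := by
  have hloops : ∀ s : E → Bool, d ^ ((G.medialDiagram.loops s : ℤ) - 1) *
      d ^ (Fintype.card V + 1) =
      ∑ σ : V → Fin q, ∏ e, if s e = G.positive e then 1 else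
        if σ (vtx (e, false)) = σ (vtx (e, true)) then d else 0 := by
    intro s
    rw [← zpow_natCast, ← zpow_add₀ hd]
    have h1 : ((G.medialDiagram.loops s : ℤ) - 1) + ((Fintype.card V + 1 : ℕ) : ℤ) =
        ((2 * Nat.card (Quot (EdgeRel vtx (contracted G s))) + (contracted G s).card : ℕ) : ℤ) := by
      rw [← hG, loops_medialDiagram]
      push_cast
      ring
    rw [h1, zpow_natCast, pow_add, pow_mul, hq, card_pow_components, Finset.sum_mul]
    refine Finset.sum_congr rfl fun σ _ => ?_
    rw [← Finset.prod_const, ← Finset.prod_mul_distrib, contracted, Finset.prod_filter]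
    refine Finset.prod_congr rfl fun e _ => ?_
    by_cases hs : s e = G.positive e <;> simp [hs]
  rw [LinkDiagram.kauffmanBracket, hAd, Finset.sum_mul]
  simp only [mul_assoc, hloops, zpow_sum_eq_prod hA, Finset.mul_sum]
  rw [Finset.sum_comm]
  refine Finset.sum_congr rfl fun σ _ => ?_
  -- The two terms are the smoothings that delete and contract `e`. For a negative edge their
  -- coefficients are exchanged.
  have h2 : ∀ e, edgeWeight (if G.positive e then A else A⁻¹) d (σ (vtx (e, false)))
      (σ (vtx (e, true))) = ∑ b : Bool, A ^ (if b then (1 : ℤ) else -1) *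
        (if b = G.positive e then 1 else
          if σ (vtx (e, false)) = σ (vtx (e, true)) then d else 0) := by
    intro e
    cases hp : G.positive e <;> simp [edgeWeight, add_comm]
  simp only [h2, Finset.prod_univ_sum, Fintype.piFinset_univ, Finset.prod_mul_distrib]

/-- The Boltzmann weight of the half-graph of a tree with spins `σ` at its vertices. -/
noncomputable def treeWeight (A d : ℂ) {q : ℕ} (T : BinaryTree Unit) (σ : ℕ → Fin q) : ℂ :=
  ∏ c, edgeWeight A d (σ (firstLeaf T c)) (σ (midLeaf T c))

/-- A finite configuration of spins as a stream. -/
def toStream {n q : ℕ} [NeZero q] (σ : Fin n → Fin q) (i : ℕ) : Fin q :=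
  if h : i < n then σ ⟨i, h⟩ else 0

theorem normalizedBracket_eq_sum {A d : ℂ} (hA : A ≠ 0) (hd : d ≠ 0)
    (hAd : -A ^ 2 - A ^ (-2 : ℤ) = d) {q : ℕ} [NeZero q] (hq : d ^ 2 = q)
    {Tp Tm : BinaryTree Unit} (h : Tp.numLeaves = Tm.numLeaves) :
    normalizedBracket A Tp Tm = d⁻¹ * ((q : ℂ)⁻¹ ^ Tp.numLeaves *
      ∑ σ : Fin Tp.numLeaves → Fin q,
        treeWeight A d Tp (toStream σ) * treeWeight A⁻¹ d Tm (toStream σ)) := by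
  have key := kauffmanBracket_medialDiagram (gammaGraph Tp Tm) (pairVertexFin h)
    (fun S => by rw [Fintype.card_fin]; exact card_faces_gammaGraph h S) hA hd hAd hq
  have hsum : ∀ σ : Fin Tp.numLeaves → Fin q,
      (∏ e, edgeWeight (if (gammaGraph Tp Tm).positive e then A else A⁻¹) d
        (σ (pairVertexFin h (e, false))) (σ (pairVertexFin h (e, true)))) =
      treeWeight A d Tp (toStream σ) * treeWeight A⁻¹ d Tm (toStream σ) := by
    intro σ
    rw [Fintype.prod_sum_type]
    congr 1
    · refine Finset.prod_congr rfl fun c _ => ?_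
      rw [toStream, toStream, dif_pos (firstLeaf_lt Tp c), dif_pos (midLeaf_lt Tp c)]
      rfl
    · refine Finset.prod_congr rfl fun c _ => ?_
      rw [toStream, toStream, dif_pos (h ▸ firstLeaf_lt Tm c), dif_pos (h ▸ midLeaf_lt Tm c)]
      rfl
  rw [Finset.sum_congr rfl fun σ _ => hsum σ, Fintype.card_fin] at key
  -- The normalization `d ^ (-n)` and the factor `d ^ (n + 1)` from Euler's formula combine to `d⁻¹
  -- * q ^ (-n)`.
  rw [← key, normalizedBracket, hAd, linkOfTrees, ← hq, zpow_neg, zpow_natCast, inv_pow,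
    ← pow_mul]
  field_simp
  ring

/-! ## Averages over spin configurations -/

section SpinMean

variable {q : ℕ}

/-- Put a spin in front of a stream of spins. -/
def consStream (x : Fin q) (σ : ℕ → Fin q) : ℕ → Fin q
  | 0 => x
  | i + 1 => σ i

/-- Put the first `m` spins of a stream in front of another one. -/
def appendStream (m : ℕ) (σ τ : ℕ → Fin q) (i : ℕ) : Fin q :=
  if i < m then σ i else τ (i - m)

theorem consStream_appendStream (m : ℕ) (x : Fin q) (σ τ : ℕ → Fin q) :
    appendStream (m + 1) (consStream x σ) τ = consStream x (appendStream m σ τ) := by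
  ext i
  cases i with
  | zero => simp [appendStream, consStream]
  | succ i => simp [appendStream, consStream]

variable [NeZero q]

/-- The average over the first `n` spins. -/
noncomputable def spinMean : ℕ → ((ℕ → Fin q) → ℂ) → ℂ
  -- The remaining spins are set to 0, in agreement with `toStream`.
  | 0, G => G fun _ => 0
  | n + 1, G => (q : ℂ)⁻¹ * ∑ x, spinMean n fun σ => G (consStream x σ)

theorem sum_toStream_eq_spinMean : ∀ (n : ℕ) (G : (ℕ → Fin q) → ℂ),
    (q : ℂ)⁻¹ ^ n * ∑ σ : Fin n → Fin q, G (toStream σ) = spinMean n G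
  | 0, G => by
      have : ∀ σ : Fin 0 → Fin q, toStream σ = fun _ => 0 := fun σ => by
        ext i
        simp [toStream]
      simp [spinMean, this]
  | n + 1, G => by
      have h : ∀ (x : Fin q) (σ : Fin n → Fin q),
          toStream (Fin.cons x σ : Fin (n + 1) → Fin q) = consStream x (toStream σ) := by
        intro x σ
        funext i
        cases i with
        | zero => simp [toStream, consStream]
        | succ i =>
          by_cases hi : i < n
          · simpa [toStream, consStream, hi] using
              Fin.cons_succ (α := fun _ => Fin q) x σ ⟨i, hi⟩
          · simp [toStream, consStream, hi]
      rw [spinMean, ← (Fin.consEquiv fun _ => Fin q).sum_comp, Fintype.sum_prod_type, pow_succ',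
        mul_assoc, Finset.mul_sum]
      congr 1
      refine Finset.sum_congr rfl fun x _ => ?_
      rw [← sum_toStream_eq_spinMean n]
      congr 1
      exact Finset.sum_congr rfl fun σ _ => congrArg G (h x σ)

theorem spinMean_add (n : ℕ) : ∀ (m : ℕ) (G : (ℕ → Fin q) → ℂ),
    spinMean (m + n) G = spinMean m fun σ => spinMean n fun τ => G (appendStream m σ τ)
  | 0, G => by
      rw [Nat.zero_add]
      rfl
  | m + 1, G => by
      rw [Nat.add_right_comm, spinMean, spinMean]
      simp only [spinMean_add n m, consStream_appendStream]

theorem spinMean_const_mul (c : ℂ) : ∀ (n : ℕ) (G : (ℕ → Fin q) → ℂ),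
    (spinMean n fun σ => c * G σ) = c * spinMean n G
  | 0, G => rfl
  | n + 1, G => by
      simp only [spinMean, spinMean_const_mul c n, ← Finset.mul_sum]
      ring

theorem spinMean_mul_const (c : ℂ) (n : ℕ) (G : (ℕ → Fin q) → ℂ) :
    (spinMean n fun σ => G σ * c) = spinMean n G * c := by
  simp only [mul_comm _ c, spinMean_const_mul]

end SpinMean

/-! ## Weights of trees -/

section Weights

variable {q : ℕ} (A d : ℂ)

theorem treeWeight_nil (σ : ℕ → Fin q) : treeWeight A d .nil σ = 1 :=
  Fintype.prod_empty (ι := Empty) _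

theorem treeWeight_node (l r : BinaryTree Unit) (σ : ℕ → Fin q) :
    treeWeight A d (.node () l r) σ = edgeWeight A d (σ 0) (σ l.numLeaves) *
      (treeWeight A d l σ * treeWeight A d r fun i => σ (l.numLeaves + i)) := by
  have : treeWeight A d (.node () l r) σ = ∏ c : Option (Caret l ⊕ Caret r),
      edgeWeight A d (σ (firstLeaf (.node () l r) c)) (σ (midLeaf (.node () l r) c)) :=
    Fintype.prod_equiv (Equiv.refl _) _ _ fun c => rfl
  rw [this, Fintype.prod_option, Fintype.prod_sum_type]
  rfl

theorem treeWeight_congr (T : BinaryTree Unit) {σ τ : ℕ → Fin q}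
    (h : ∀ i < T.numLeaves, σ i = τ i) : treeWeight A d T σ = treeWeight A d T τ :=
  Finset.prod_congr rfl fun c _ => by rw [h _ (firstLeaf_lt T c), h _ (midLeaf_lt T c)]

/-- The first leaf of the `i`-th tree of a forest. -/
def forestLeaf (φ : ℕ → BinaryTree Unit) (i : ℕ) : ℕ :=
  ∑ j ∈ Finset.range i, (φ j).numLeaves

theorem forestLeaf_add (φ : ℕ → BinaryTree Unit) (n i : ℕ) :
    forestLeaf φ (n + i) = forestLeaf φ n + forestLeaf (fun j => φ (n + j)) i :=
  Finset.sum_range_add _ _ _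

/-- An edge of a caret of `T` ends at first leaves of attached trees, and every other edge lies
within one attached tree. -/
theorem treeWeight_attach : ∀ (T : BinaryTree Unit) (φ : ℕ → BinaryTree Unit) (σ : ℕ → Fin q),
    treeWeight A d (attach T φ) σ = treeWeight A d T (fun i => σ (forestLeaf φ i)) *
      ∏ i ∈ Finset.range T.numLeaves, treeWeight A d (φ i) fun j => σ (forestLeaf φ i + j)
  | .nil, φ, σ => by
      simp [attach, treeWeight_nil, forestLeaf]
  | .node () l r, φ, σ => by
      rw [attach, treeWeight_node, treeWeight_node, treeWeight_attach l, treeWeight_attach r,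
        BinaryTree.numLeaves, Finset.prod_range_add, numLeaves_attach]
      change edgeWeight A d (σ 0) (σ (forestLeaf φ l.numLeaves)) * (_ *
        (treeWeight A d r (fun i => σ (forestLeaf φ l.numLeaves + _)) *
          ∏ i ∈ Finset.range r.numLeaves, treeWeight A d (φ (l.numLeaves + i))
            fun j => σ (forestLeaf φ l.numLeaves + (_ + j)))) = _
      have h0 : forestLeaf φ 0 = 0 := rfl
      simp only [forestLeaf_add, h0, add_assoc]
      ring

/-- The weight of the closed graph of the pair `(T, T)`. -/
noncomputable def doubleWeight (T : BinaryTree Unit) (σ : ℕ → Fin q) : ℂ :=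
  treeWeight A d T σ * treeWeight A⁻¹ d T σ

variable {A d}

/-- The second vertex of a bigon with one positive and one negative edge can be removed. -/
theorem sum_edgeWeight_mul (hA : A ≠ 0) (hAd : -A ^ 2 - A ^ (-2 : ℤ) = d)
    (x : Fin q) : ∑ y, edgeWeight A d x y * edgeWeight A⁻¹ d x y = q := by
  -- The excess on the diagonal vanishes because `A² + A⁻² = -d`, so the two weights are mutually
  -- inverse: the second Reidemeister move.
  have h : ∀ y, edgeWeight A d x y * edgeWeight A⁻¹ d x y =
      1 + if x = y then (A ^ 2 + (A⁻¹) ^ 2) * d + d ^ 2 else 0 := by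
    intro y
    rw [edgeWeight, edgeWeight, inv_inv]
    split_ifs
    · field_simp
      ring
    · simp [hA]
  have hd : (A ^ 2 + (A⁻¹) ^ 2) = -d := by
    rw [← hAd, zpow_neg, inv_pow]
    norm_cast
    ring
  simp only [h, Finset.sum_add_distrib, Finset.sum_ite_eq, Finset.mem_univ, if_true, hd]
  simp
  ring

variable [NeZero q]

/-- The first spin stays fixed and the other `numNodes` are averaged. The right subtree gives 1 for
each value of its own first spin; what remains there is the bigon of the two root edges, which also
averages to 1, and then the left subtree. -/
theorem spinMean_doubleWeight (hA : A ≠ 0) (hAd : -A ^ 2 - A ^ (-2 : ℤ) = d) :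
    ∀ (T : BinaryTree Unit) (x : Fin q),
      (spinMean T.numNodes fun σ => doubleWeight A d T (consStream x σ)) = 1
  | .nil, x => by simp [spinMean, doubleWeight, treeWeight_nil]
  | .node () l r, x => by
      have hq0 : (q : ℂ) ≠ 0 := Nat.cast_ne_zero.2 (NeZero.ne q)
      have key : ∀ σ τ : ℕ → Fin q,
          doubleWeight A d (.node () l r) (consStream x (appendStream l.numNodes σ τ)) =
            doubleWeight A d l (consStream x σ) *
              (edgeWeight A d x (τ 0) * edgeWeight A⁻¹ d x (τ 0) * doubleWeight A d r τ) := by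
        intro σ τ
        have h1 : ∀ i < l.numLeaves,
            consStream x (appendStream l.numNodes σ τ) i = consStream x σ i := by
          intro i hi
          rw [BinaryTree.numLeaves_eq_numNodes_succ] at hi
          cases i with
          | zero => rfl
          | succ i => simp [consStream, appendStream, Nat.lt_of_succ_lt_succ hi]
        have h2 : ∀ i,
            consStream x (appendStream l.numNodes σ τ) (l.numLeaves + i) = τ i := by
          intro i
          rw [BinaryTree.numLeaves_eq_numNodes_succ, Nat.add_right_comm]
          simp [consStream, appendStream]
        have h3 := h2 0
        rw [Nat.add_zero] at h3
        have h4 : consStream x (appendStream l.numNodes σ τ) 0 = x := rfl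
        simp only [doubleWeight, treeWeight_node, treeWeight_congr _ _ l h1, h2, h3, h4]
        ring
      have hn : (BinaryTree.node () l r).numNodes = l.numNodes + (r.numNodes + 1) := by
        simp only [BinaryTree.numNodes]
        ring
      have hr : (spinMean (r.numNodes + 1) fun τ => edgeWeight A d x (τ 0) *
          edgeWeight A⁻¹ d x (τ 0) * doubleWeight A d r τ) = 1 := by
        rw [spinMean]
        have : ∀ y : Fin q, (spinMean r.numNodes fun τ => edgeWeight A d x (consStream y τ 0) *
            edgeWeight A⁻¹ d x (consStream y τ 0) * doubleWeight A d r (consStream y τ)) =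
            edgeWeight A d x y * edgeWeight A⁻¹ d x y := by
          intro y
          simp only [consStream, spinMean_const_mul, spinMean_doubleWeight hA hAd r y, mul_one]
        rw [Finset.sum_congr rfl fun y _ => this y, sum_edgeWeight_mul hA hAd,
          inv_mul_cancel₀ hq0]
      rw [hn, spinMean_add]
      simp only [key, spinMean_const_mul, hr, mul_one]
      exact spinMean_doubleWeight hA hAd l x

/-- `G` sees only the first spin of each tree. Averaging over the others removes the double weights,
tree by tree. -/
theorem spinMean_forest (hA : A ≠ 0) (hAd : -A ^ 2 - A ^ (-2 : ℤ) = d) :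
    ∀ (n : ℕ) (φ : ℕ → BinaryTree Unit) (G : (ℕ → Fin q) → ℂ),
      (spinMean (forestLeaf φ n) fun σ => G (fun i => σ (forestLeaf φ i)) *
        ∏ i ∈ Finset.range n, doubleWeight A d (φ i) fun j => σ (forestLeaf φ i + j)) =
      spinMean n G
  | 0, φ, G => by simp [forestLeaf, spinMean]
  | n + 1, φ, G => by
      have hsucc : ∀ i, forestLeaf φ (i + 1) =
          (φ 0).numLeaves + forestLeaf (fun j => φ (j + 1)) i := by
        intro i
        rw [forestLeaf, Finset.sum_range_succ', add_comm]
        rfl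
      have key : ∀ σ τ : ℕ → Fin q,
          G (fun i => appendStream (φ 0).numLeaves σ τ (forestLeaf φ i)) *
            ∏ i ∈ Finset.range (n + 1), doubleWeight A d (φ i)
              (fun j => appendStream (φ 0).numLeaves σ τ (forestLeaf φ i + j)) =
          doubleWeight A d (φ 0) σ *
            (G (consStream (σ 0) fun i => τ (forestLeaf (fun j => φ (j + 1)) i)) *
              ∏ i ∈ Finset.range n, doubleWeight A d (φ (i + 1))
                fun j => τ (forestLeaf (fun j => φ (j + 1)) i + j)) := by
        intro σ τ
        have h1 : (fun i => appendStream (φ 0).numLeaves σ τ (forestLeaf φ i)) =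
            consStream (σ 0) fun i => τ (forestLeaf (fun j => φ (j + 1)) i) := by
          funext i
          cases i with
          | zero => simp [forestLeaf, appendStream, consStream, (φ 0).numLeaves_pos]
          | succ i => simp [hsucc, appendStream, consStream]
        have h2 : doubleWeight A d (φ 0)
            (fun j => appendStream (φ 0).numLeaves σ τ (forestLeaf φ 0 + j)) =
            doubleWeight A d (φ 0) σ := by
          have h3 : ∀ j < (φ 0).numLeaves,
              appendStream (φ 0).numLeaves σ τ (forestLeaf φ 0 + j) = σ j := by
            intro j hj
            simp [forestLeaf, appendStream, hj]
          rw [doubleWeight, treeWeight_congr _ _ _ h3, treeWeight_congr _ _ _ h3]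
          rfl
        have h4 : ∀ i j, appendStream (φ 0).numLeaves σ τ (forestLeaf φ (i + 1) + j) =
            τ (forestLeaf (fun j => φ (j + 1)) i + j) := by
          intro i j
          simp [hsucc, appendStream, add_assoc]
        rw [h1, Finset.prod_range_succ', h2]
        simp only [h4]
        ring
      rw [hsucc, spinMean_add]
      have ih : ∀ x : Fin q, (spinMean (forestLeaf (fun j => φ (j + 1)) n) fun τ =>
          G (consStream x fun i => τ (forestLeaf (fun j => φ (j + 1)) i)) *
            ∏ i ∈ Finset.range n, doubleWeight A d (φ (i + 1))
              fun j => τ (forestLeaf (fun j => φ (j + 1)) i + j)) =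
          spinMean n fun τ => G (consStream x τ) := fun x =>
        spinMean_forest hA hAd n (fun j => φ (j + 1)) fun τ => G (consStream x τ)
      simp only [key, spinMean_const_mul, ih]
      rw [BinaryTree.numLeaves_eq_numNodes_succ, spinMean, spinMean]
      congr 1
      refine Finset.sum_congr rfl fun x _ => ?_
      have h0 : ∀ σ, consStream x σ 0 = x := fun σ => rfl
      simp only [h0, spinMean_mul_const, spinMean_doubleWeight hA hAd, one_mul]

end Weights

/-! ## The function on Thompson's group -/

/-- This is the source of positivity: for `|A| = 1` and real `d`, reflecting a half-graph conjugates
its weight. -/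
theorem starRingEnd_treeWeight {A d : ℂ} {q : ℕ} (hA : starRingEnd ℂ A = A⁻¹)
    (hd : starRingEnd ℂ d = d) (T : BinaryTree Unit) (σ : ℕ → Fin q) :
    starRingEnd ℂ (treeWeight A d T σ) = treeWeight A⁻¹ d T σ := by
  rw [treeWeight, map_prod]
  refine Finset.prod_congr rfl fun c _ => ?_
  rw [edgeWeight, edgeWeight]
  split_ifs <;> simp [hA, hd]

section Bracket

variable {A d : ℂ} {q : ℕ} [NeZero q]

theorem normalizedBracket_eq_spinMean (hA : A ≠ 0) (hd : d ≠ 0)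
    (hAd : -A ^ 2 - A ^ (-2 : ℤ) = d) (hq : d ^ 2 = q)
    {Tp Tm : BinaryTree Unit} (h : Tp.numLeaves = Tm.numLeaves) :
    normalizedBracket A Tp Tm = d⁻¹ * spinMean (q := q) Tp.numLeaves
      fun σ => treeWeight A d Tp σ * treeWeight A⁻¹ d Tm σ := by
  rw [normalizedBracket_eq_sum hA hd hAd hq h, ← sum_toStream_eq_spinMean]

theorem normalizedBracket_attach (hA : A ≠ 0) (hd : d ≠ 0)
    (hAd : -A ^ 2 - A ^ (-2 : ℤ) = d) (hq : d ^ 2 = q)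
    {Tp Tm : BinaryTree Unit} (h : Tp.numLeaves = Tm.numLeaves) (φ : ℕ → BinaryTree Unit) :
    normalizedBracket A (attach Tp φ) (attach Tm φ) = normalizedBracket A Tp Tm := by
  rw [normalizedBracket_eq_spinMean hA hd hAd hq h, normalizedBracket_eq_spinMean hA hd hAd hq
    (by rw [numLeaves_attach, numLeaves_attach, h]), ← spinMean_forest hA hAd Tp.numLeaves φ,
    numLeaves_attach]
  congr 2
  funext σ
  rw [treeWeight_attach, treeWeight_attach, ← h]
  simp only [doubleWeight, Finset.prod_mul_distrib]
  ring

end Bracket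

/-- A tree is determined by its dyadic subdivision. -/
theorem eq_of_unfold_eq : ∀ {S T : BinaryTree Unit},
    (∀ x, 0 ≤ x → x ≤ 1 → unfold S x = unfold T x) → S = T
  | .nil, .nil, _ => rfl
  | .nil, .node () l r, h => by
      have h1 := h 1 zero_le_one le_rfl
      rw [unfold_one, unfold_one] at h1
      have h2 := l.numLeaves_pos
      have h3 := r.numLeaves_pos
      have h4 := Nat.cast_injective h1
      simp only [BinaryTree.numLeaves] at h4
      omega
  | .node () l r, .nil, h => by
      have h1 := h 1 zero_le_one le_rfl
      rw [unfold_one, unfold_one] at h1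
      have h2 := l.numLeaves_pos
      have h3 := r.numLeaves_pos
      have h4 := Nat.cast_injective h1
      simp only [BinaryTree.numLeaves] at h4
      omega
  | .node () l r, .node () l' r', h => by
      have hl : l = l' := eq_of_unfold_eq fun x h0 h1 => by
        have := h (x / 2) (by linarith) (by linarith)
        have hx : x / 2 ≤ 1 / 2 := by linarith
        simpa only [unfold, if_pos hx, mul_div_cancel₀ x (two_ne_zero' ℝ)] using this
      subst hl
      have hr : r = r' := eq_of_unfold_eq fun x h0 h1 => by
        rcases h0.eq_or_lt with rfl | h0
        · rw [unfold_zero, unfold_zero]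
        have := h ((x + 1) / 2) (by linarith) (by linarith)
        have hx : ¬ (x + 1) / 2 ≤ 1 / 2 := by linarith
        have hx' : 2 * ((x + 1) / 2) - 1 = x := by ring
        simpa only [unfold, if_neg hx, hx', add_right_inj] using this
      rw [hr]

/-- The map and its source tree determine the subdivision of the target, as `unfold T = unfold S ∘
g⁻¹` on `[0, 1]`. -/
theorem target_eq_of_treePairMap_eq {S T T' : BinaryTree Unit} {h : S.numLeaves = T.numLeaves}
    {h' : S.numLeaves = T'.numLeaves} (he : treePairMap S T h = treePairMap S T' h') : T = T' := by
  refine eq_of_unfold_eq fun x h0 h1 => ?_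
  have h2 := unfold_treePairMap S T h ((treePairMap S T h).symm ⟨x, h0, h1⟩)
  have h3 := unfold_treePairMap S T' h' ((treePairMap S T h).symm ⟨x, h0, h1⟩)
  rw [← he, ← h2, Homeomorph.apply_symm_apply] at h3
  exact h3.symm

section Bracket

variable {A d : ℂ} {q : ℕ} [NeZero q]

/-- The normalized bracket depends only on the element of Thompson's group. -/
theorem normalizedBracket_eq_of_treePairMap_eq (hA : A ≠ 0) (hd : d ≠ 0)
    (hAd : -A ^ 2 - A ^ (-2 : ℤ) = d) (hq : d ^ 2 = q) {Sp Sm Tp Tm : BinaryTree Unit}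
    {hS : Sp.numLeaves = Sm.numLeaves} {hT : Tp.numLeaves = Tm.numLeaves}
    (he : treePairMap Sp Sm hS = treePairMap Tp Tm hT) :
    normalizedBracket A Sp Sm = normalizedBracket A Tp Tm := by
  obtain ⟨φ, ψ, h⟩ := exists_common_attach Sp Tp
  rw [← normalizedBracket_attach hA hd hAd hq hS φ, ← normalizedBracket_attach hA hd hAd hq hT ψ]
  rw [treePairMap_attach Sp Sm hS φ, treePairMap_attach Tp Tm hT ψ] at he
  have hm : attach Sm φ = attach Tm ψ := by
    have h' : (attach Sp φ).numLeaves = (attach Tm ψ).numLeaves := by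
      rw [h, numLeaves_attach, numLeaves_attach, hT]
    refine target_eq_of_treePairMap_eq (S := attach Sp φ) (h' := h') (he.trans ?_)
    simp only [h]
  rw [h, hm]

theorem kauffmanFunction_toF (hA : A ≠ 0) (hd : d ≠ 0)
    (hAd : -A ^ 2 - A ^ (-2 : ℤ) = d) (hq : d ^ 2 = q) (g : thompsonF)
    {Tp Tm : BinaryTree Unit} (h : Tp.numLeaves = Tm.numLeaves)
    (hg : (g : unitInterval ≃ₜ unitInterval) = treePairMap Tp Tm h) :
    kauffmanFunction A g = normalizedBracket A Tp Tm := by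
  obtain ⟨h', he⟩ := g.2.choose_spec.choose_spec
  exact normalizedBracket_eq_of_treePairMap_eq hA hd hAd hq (he.symm.trans hg)

/-- Finitely many elements of Thompson's group have tree pairs with a common source. -/
theorem exists_common_source : ∀ (r : ℕ) (g : Fin r → thompsonF),
    ∃ (S : BinaryTree Unit) (T : Fin r → BinaryTree Unit), ∀ i,
      ∃ h : S.numLeaves = (T i).numLeaves, (g i : unitInterval ≃ₜ unitInterval) =
        treePairMap S (T i) h
  | 0, _ => ⟨.nil, fun _ => .nil, fun i => i.elim0⟩
  | r + 1, g => by
      obtain ⟨S, T, hST⟩ := exists_common_source r fun i => g i.succ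
      obtain ⟨Sp, Sm, hS, hg⟩ := (g 0).2
      obtain ⟨φ, ψ, h⟩ := exists_common_attach S Sp
      refine ⟨attach S φ, Fin.cons (attach Sm ψ) fun i => attach (T i) φ, Fin.cases ?_ fun i => ?_⟩
      · have h' : (attach S φ).numLeaves = (attach Sm ψ).numLeaves := by
          rw [h, numLeaves_attach, numLeaves_attach, hS]
        refine ⟨h', hg.trans ((treePairMap_attach Sp Sm hS ψ).trans ?_)⟩
        simp only [h, Fin.cons_zero]
      · obtain ⟨h1, h2⟩ := hST i
        exact ⟨by simp [numLeaves_attach, h1], h2.trans (treePairMap_attach S (T i) h1 φ)⟩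

open scoped ComplexOrder in
-- With a common source, the matrix of values is a positive multiple of a Gram matrix of the vectors
-- of target weights, so the quadratic form is a sum of squared absolute values.
theorem isPositiveType_kauffmanFunction (hA : A ≠ 0) (hAA : starRingEnd ℂ A = A⁻¹) {d : ℝ}
    (hd : 0 < d) (hAd : -A ^ 2 - A ^ (-2 : ℤ) = d) (hq : d ^ 2 = q) :
    IsPositiveType (kauffmanFunction A) := by
  intro r g a
  have hd' : (d : ℂ) ≠ 0 := Complex.ofReal_ne_zero.2 hd.ne'
  have hq' : (d : ℂ) ^ 2 = q := by exact_mod_cast hq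
  obtain ⟨S, T, hST⟩ := exists_common_source r g
  have hval : ∀ i j, kauffmanFunction A (g i * (g j)⁻¹) = (d : ℂ)⁻¹ * ((q : ℂ)⁻¹ ^ S.numLeaves *
      ∑ σ : Fin S.numLeaves → Fin q, treeWeight A d (T j) (toStream σ) *
        starRingEnd ℂ (treeWeight A d (T i) (toStream σ))) := by
    intro i j
    obtain ⟨hi, hi'⟩ := hST i
    obtain ⟨hj, hj'⟩ := hST j
    have hji : (T j).numLeaves = (T i).numLeaves := hj.symm.trans hi
    rw [kauffmanFunction_toF hA hd' hAd hq' (g i * (g j)⁻¹) hji,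
      normalizedBracket_eq_spinMean hA hd' hAd hq' hji, ← hj, ← sum_toStream_eq_spinMean]
    · simp only [starRingEnd_treeWeight hAA (Complex.conj_ofReal d)]
    -- `gⱼ⁻¹` leads from `Tⱼ` to `S`, then `gᵢ` from `S` to `Tᵢ`.
    · refine eq_treePairMap hji fun x => ?_
      rw [Subgroup.coe_mul, Subgroup.coe_inv, hi', hj', Homeomorph.mul_apply, unfold_treePairMap,
        ← unfold_treePairMap S (T j) hj]
      exact congrArg (fun y : unitInterval => unfold (T j) y)
        ((treePairMap S (T j) hj).apply_symm_apply x)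
  have hsum : ∑ i, ∑ j, a i * starRingEnd ℂ (a j) * kauffmanFunction A (g i * (g j)⁻¹) =
      ((d⁻¹ * ((q : ℝ)⁻¹ ^ S.numLeaves * ∑ σ : Fin S.numLeaves → Fin q,
        Complex.normSq (∑ i, a i * starRingEnd ℂ (treeWeight A d (T i) (toStream σ)))) : ℝ) :
          ℂ) := by
    push_cast
    simp only [hval, Complex.normSq_eq_conj_mul_self, map_sum, map_mul, Complex.conj_conj,
      Finset.sum_mul_sum]
    simp only [Finset.mul_sum]
    rw [Finset.sum_comm]
    conv_rhs => rw [Finset.sum_comm]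
    refine Finset.sum_congr rfl fun j _ => ?_
    rw [Finset.sum_comm]
    refine Finset.sum_congr rfl fun σ _ => Finset.sum_congr rfl fun i _ => ?_
    ring
  rw [hsum, Complex.zero_le_real]
  have : 0 ≤ ∑ σ : Fin S.numLeaves → Fin q,
      Complex.normSq (∑ i, a i * starRingEnd ℂ (treeWeight A d (T i) (toStream σ))) :=
    Finset.sum_nonneg fun σ _ => Complex.normSq_nonneg _
  positivity

end Bracket

/-- Squaring shows that `x = A ^ 4` is a root of `x² + (2 - Q) x + 1`, which is `x² + 1`, `x² - x +
1` or `(x - 1)²`. Hence `x ^ 4`, `x ^ 6` or `x` equals 1. -/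
theorem exists_pow_eq_one {Q : ℕ} (hQ : Q = 2 ∨ Q = 3 ∨ Q = 4) {A : ℂ} (hA0 : A ≠ 0)
    (hA : A ^ 2 + A ^ (-2 : ℤ) + ((Real.sqrt (Q : ℝ) : ℝ) : ℂ) = 0) :
    ∃ k : ℕ, 0 < k ∧ A ^ k = 1 := by
  have hs : ((Real.sqrt (Q : ℝ) : ℝ) : ℂ) ^ 2 = Q := by
    rw [← Complex.ofReal_pow, Real.sq_sqrt (Nat.cast_nonneg Q), Complex.ofReal_natCast]
  have h1 : (A ^ 2 + A ^ (-2 : ℤ)) ^ 2 = Q := by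
    rw [eq_neg_of_add_eq_zero_left hA, neg_sq, hs]
  have h2 : (A ^ 4 + 1) ^ 2 = Q * A ^ 4 := by
    rw [← h1, zpow_neg, show (2 : ℤ) = ((2 : ℕ) : ℤ) from rfl, zpow_natCast]
    field_simp
  rcases hQ with rfl | rfl | rfl
  · refine ⟨16, by norm_num, ?_⟩
    push_cast at h2
    linear_combination (A ^ 8 - 1) * h2
  · refine ⟨24, by norm_num, ?_⟩
    push_cast at h2
    linear_combination (A ^ 12 - 1) * (A ^ 4 + 1) * h2
  · refine ⟨4, by norm_num, ?_⟩
    push_cast at h2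
    have h3 : (A ^ 4 - 1) ^ 2 = 0 := by linear_combination h2
    linear_combination pow_eq_zero_iff (two_ne_zero) |>.1 h3

end ThompsonLink

theorem theorem5p4 (Q : ℕ) (hQ : Q = 2 ∨ Q = 3 ∨ Q = 4) (A : ℂ)
    (hA : A ^ 2 + A ^ (-2 : ℤ) + ((Real.sqrt (Q : ℝ) : ℝ) : ℂ) = 0) :
    (∃ k : ℕ, 0 < k ∧ A ^ k = 1) ∧
    (∀ (Tp Tm : BinaryTree Unit) (h : Tp.numLeaves = Tm.numLeaves),
      ThompsonLink.kauffmanFunction A (ThompsonLink.toF Tp Tm h) =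
        (-A ^ 2 - A ^ (-2 : ℤ)) ^ (-(Tp.numLeaves : ℤ)) *
          (ThompsonLink.linkOfTrees Tp Tm).kauffmanBracket A) ∧
    ThompsonLink.IsPositiveType (ThompsonLink.kauffmanFunction A) := by
  have hQ0 : 0 < Q := by omega
  have : NeZero Q := ⟨hQ0.ne'⟩
  have hd : 0 < Real.sqrt (Q : ℝ) := Real.sqrt_pos.2 (Nat.cast_pos.2 hQ0)
  have hd' : ((Real.sqrt (Q : ℝ) : ℝ) : ℂ) ≠ 0 := Complex.ofReal_ne_zero.2 hd.ne'
  have hq : Real.sqrt (Q : ℝ) ^ 2 = Q := Real.sq_sqrt (Nat.cast_nonneg Q)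
  have hq' : ((Real.sqrt (Q : ℝ) : ℝ) : ℂ) ^ 2 = Q := by exact_mod_cast hq
  have hA0 : A ≠ 0 := by
    -- Since `0 ^ (-2) = 0` by convention, `A = 0` would give `√Q = 0`.
    rintro rfl
    rw [zero_pow two_ne_zero, zero_zpow _ (by norm_num), add_zero, zero_add] at hA
    exact hd' hA
  have hAd : -A ^ 2 - A ^ (-2 : ℤ) = ((Real.sqrt (Q : ℝ) : ℝ) : ℂ) := by
    linear_combination -hA
  obtain ⟨k, hk, hAk⟩ := ThompsonLink.exists_pow_eq_one hQ hA0 hA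
  refine ⟨⟨k, hk, hAk⟩, fun Tp Tm h => ?_, ?_⟩
  · exact ThompsonLink.kauffmanFunction_toF hA0 hd' hAd hq' _ h rfl
  · exact ThompsonLink.isPositiveType_kauffmanFunction hA0
      (Complex.inv_eq_conj (Complex.norm_eq_one_of_pow_eq_one hAk hk.ne')).symm hd hAd hq
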